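/- Let $M\in\mathbb N$ and let $\mathcal A\subset\{0,1,\dots,M-1\}$ satisfy $1<|\mathcal A|<M$; put $\delta=\log|\mathcal A|/\log M\in(0,1)$. For $\chi\in C_c^\infty((0,1);[0,1])$ and $N=M^k$, $k\ge1$, let $\mathcal F_N$ be the unitary discrete Fourier transform on $\ell^2_N=\mathbb C^{\{0,\dots,N-1\}}$, $(\mathcal F_Nu)(j)=N^{-1/2}\sum_{l=0}^{N-1}e^{-2\pi i jl/N}u(l)$. The quantum open baker's map is $$B_N=\mathcal F_N^*\,\operatorname{diag}\bigl(\chi_{N/M}\mathcal F_{N/M}\chi_{N/M},\dots,\chi_{N/M}\mathcal F_{N/M}\chi_{N/M}\bigr)\,I_{\mathcal A,M},$$ with $M$ diagonal blocks, where $\chi_{N/M}$ is multiplication by $\chi(Mj/N)$, $0\le j<N/M$, and $I_{\mathcal A,M}$ is the diagonal matrix whose $j$th entry is $1$ if $\lfloor Mj/N\rfloor\in\mathcal A$ and $0$ otherwise. Let $$\mathcal N_k(\nu)=\#\{\lambda\in\operatorname{Sp}(B_N):|\lambda|\ge M^{-\nu}\},$$ eigenvalues being counted with algebraic multiplicity.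 Let $C_k=\{\sum_{j=0}^{k-1}a_jM^j: a_0,\dots,a_{k-1}\in\mathcal A\}\subset\mathbb Z/N\mathbb Z$, let $E(C_k)=\#\{(a,b,c,d)\in C_k^4: a+b\equiv c+d \pmod N\}$ be its additive energy, and let $\gamma_{\mathcal A}$ be the supremum of all real $\gamma$ such that for every $\varepsilon>0$ there is $C_\varepsilon>0$ with $E(C_k)\le C_\varepsilon N^{3\delta-\gamma+\varepsilon}$ for all $k$. Put $$\beta_E=\tfrac34\bigl(\tfrac12-\delta\bigr)+\tfrac{\gamma_{\mathcal A}}8 .$$ Then $\gamma_{\mathcal A}>0$, and there is $\beta>\tfrac12-\delta$, depending only on $M$ and $\mathcal A$, such that for every $\chi\in C_c^\infty((0,1);[0,1])$, every $\nu>0$ and every $\varepsilon>0$ there is a constant $C>0$ with $$\mathcal N_k(\nu)\le C\,N^{m(\nu,\delta)+\varepsilon}\qquad\text{for all }k\ge1,\ N=M^k,$$ where $$m(\nu,\delta)=\min\Bigl(4(\nu-\beta),\;4(\nu-\beta_E),\;2\bigl(\nu-(\tfrac12-\delta)\bigr),\;\delta\Bigr).$$ -/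

import Mathlib

noncomputable section

namespace OpenBaker

/-- Entry `(j, l)` of the unitary discrete Fourier transform `F_N` on `ℓ²_N`. -/
def fourierEntry (N j l : ℕ) : ℂ :=
  Complex.exp (-(2 * (Real.pi : ℂ) * Complex.I * (j : ℂ) * (l : ℂ) / (N : ℂ))) / (Real.sqrt N : ℂ)

/-- The unitary discrete Fourier transform `F_N`, indices running over `{0, …, N - 1}`. -/
def fourierMatrix (N : ℕ) : Matrix (Fin N) (Fin N) ℂ :=
  Matrix.of fun j l => fourierEntry N j l

/-- The matrix `χ_n F_n χ_n` (entry `(j, l)`), where `χ_n` is multiplication by `χ(j / n)`. -/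
def cutoffFourierEntry (χ : ℝ → ℝ) (n j l : ℕ) : ℂ :=
  (χ ((j : ℝ) / n) : ℂ) * fourierEntry n j l * (χ ((l : ℝ) / n) : ℂ)

/-- The `N × N` block-diagonal matrix with `M` diagonal blocks, all equal to
`χ_{N/M} F_{N/M} χ_{N/M}` (used when `M` divides `N`). The index `j` lies in block number
`j / (N / M)`, at position `j % (N / M)`. -/
def blockMatrix (M : ℕ) (χ : ℝ → ℝ) (N : ℕ) : Matrix (Fin N) (Fin N) ℂ :=
  Matrix.of fun j l =>
    if (j : ℕ) / (N / M) = (l : ℕ) / (N / M) then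
      cutoffFourierEntry χ (N / M) ((j : ℕ) % (N / M)) ((l : ℕ) % (N / M))
    else 0

/-- The diagonal matrix `I_{A,M}`, with `j`-th entry `1` if `⌊M j / N⌋ ∈ A` and `0` otherwise. -/
def alphabetProjection (M : ℕ) (A : Finset (Fin M)) (N : ℕ) : Matrix (Fin N) (Fin N) ℂ :=
  Matrix.diagonal fun j => if ∃ a ∈ A, (a : ℕ) = M * (j : ℕ) / N then 1 else 0

/-- The quantum open baker's map `B_N` determined by `(M, A, χ)`. -/
def bakerMap (M : ℕ) (A : Finset (Fin M)) (χ : ℝ → ℝ) (N : ℕ) : Matrix (Fin N) (Fin N) ℂ :=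
  (fourierMatrix N).conjTranspose * blockMatrix M χ N * alphabetProjection M A N

open Classical in
/-- The number of eigenvalues `z` of `B_N`, `N = M ^ k`, with `|z| ≥ M ^ (-ν)`, counted with
algebraic multiplicity. -/
def eigenvalueCount (M : ℕ) (A : Finset (Fin M)) (χ : ℝ → ℝ) (k : ℕ) (ν : ℝ) : ℕ :=
  Multiset.card
    ((bakerMap M A χ (M ^ k)).charpoly.roots.filter fun z : ℂ => (M : ℝ) ^ (-ν) ≤ ‖z‖)

/-- The dimension `δ = log |A| / log M` of the limiting Cantor set. -/
def dim (M : ℕ) (A : Finset (Fin M)) : ℝ :=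
  Real.log A.card / Real.log M

/-- The discrete Cantor set `C_k ⊆ ℤ / M ^ k` of the numbers all of whose `k` base-`M` digits
lie in `A`. -/
def cantorSet (M : ℕ) (A : Finset (Fin M)) (k : ℕ) : Finset (ZMod (M ^ k)) :=
  (Fintype.piFinset fun _ : Fin k => A).image fun a =>
    ((∑ i : Fin k, (a i : ℕ) * M ^ (i : ℕ) : ℕ) : ZMod (M ^ k))

/-- The additive-energy exponent `γ_A`: the best `γ` such that for every `ε > 0` the additive
energy of `C_k` in `ℤ / N`, `N = M ^ k`, is at most `C_ε N ^ (3 δ - γ + ε)` for all `k`.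
Here `Finset.addEnergy s s` is the number of `(a, b, c, d) ∈ s ^ 4` with `a + b = c + d`. -/
def gammaA (M : ℕ) (A : Finset (Fin M)) : ℝ :=
  sSup {γ : ℝ | ∀ ε : ℝ, 0 < ε → ∃ C : ℝ, 0 < C ∧ ∀ k : ℕ,
    ((cantorSet M A k).addEnergy (cantorSet M A k) : ℝ) ≤
      C * ((M : ℝ) ^ k) ^ (3 * dim M A - γ + ε)}

/-- The additive-energy gap `β_E = (3/4) (1/2 - δ) + γ_A / 8`. -/
def betaE (M : ℕ) (A : Finset (Fin M)) : ℝ :=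
  3 / 4 * (1 / 2 - dim M A) + gammaA M A / 8

/-- The exponent
`m = min (4 (ν - β), 4 (ν - β_E), 2 (ν - (1/2 - δ)), δ)`. -/
def weylExponent (M : ℕ) (A : Finset (Fin M)) (β ν : ℝ) : ℝ :=
  min (min (4 * (ν - β)) (4 * (ν - betaE M A)))
    (min (2 * (ν - (1 / 2 - dim M A))) (dim M A))

end OpenBaker

end

/-!
Write `N = M ^ k` and `T = B_N ^ k`. By repeated summation by parts, `B_N` is concentrated near the
graph of the expanding map `x ↦ M x mod 1`, so after `k` steps `T = T P + O(N ^ (-K))`, where `P`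
is the projection onto a small neighbourhood `X` of the discrete Cantor set `C_k`. Since `F_N`
intertwines `B_N` with its transpose, also `T = Q T + O(N ^ (-K))` for `Q = F_N^* P F_N`. By Schur's
inequality the second moments of the eigenvalues of `T` and of `T ^ 2` are then at most a constant
times the squared Hilbert–Schmidt norms of `P Q` and of `P Q (P Q)^*`. The former gives the exponent
`2 (ν - (1 / 2 - δ))`. The latter is `N⁻²` times the exponential sum
`∑_{x, x' ∈ X} |∑_{y ∈ X} e(y (x - x') / N)|²`, which is comparable to the same sum over `C_k`.
That sum is submultiplicative in `k` and beats the trivial bound at `k = 2`, which gives `β`; by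
Cauchy–Schwarz and Parseval it is controlled by the additive energy of `C_k`, which gives `β_E`.
Finally, the columns of `T` outside `X` are negligible, so Jensen's formula for the characteristic
polynomial bounds the number of eigenvalues by a multiple of `#X`, which gives the exponent `δ`.
-/

namespace OpenBaker

open Finset Matrix Polynomial
open scoped Matrix.Norms.L2Operator Kronecker Pointwise

section HilbertSchmidt

variable {m n p : Type*} [Fintype m] [Fintype n] [Fintype p]

/-- The squared Hilbert–Schmidt norm of a matrix. Mathlib's Frobenius norm is a norm instance on
matrices, which would clash with the operator norm used here. -/
noncomputable def hsNormSq (A : Matrix m n ℂ) : ℝ := ∑ i, ∑ j, ‖A i j‖ ^ 2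

theorem hsNormSq_nonneg (A : Matrix m n ℂ) : 0 ≤ hsNormSq A := by
  unfold hsNormSq; positivity

theorem hsNormSq_transpose (A : Matrix m n ℂ) : hsNormSq Aᵀ = hsNormSq A := sum_comm

theorem hsNormSq_conjTranspose (A : Matrix m n ℂ) : hsNormSq Aᴴ = hsNormSq A := by
  unfold hsNormSq; rw [sum_comm]; simp only [conjTranspose_apply, norm_star]

theorem hsNormSq_one [DecidableEq m] : hsNormSq (1 : Matrix m m ℂ) = Fintype.card m := by
  simp [hsNormSq, Matrix.one_apply, apply_ite]

theorem hsNormSq_add_le (A B : Matrix m n ℂ) :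
    hsNormSq (A + B) ≤ 2 * hsNormSq A + 2 * hsNormSq B := by
  simp only [hsNormSq, mul_sum, ← sum_add_distrib]
  gcongr with i _ j _
  calc ‖A i j + B i j‖ ^ 2 ≤ (‖A i j‖ + ‖B i j‖) ^ 2 := by gcongr; exact norm_add_le _ _
    _ ≤ 2 * (‖A i j‖ ^ 2 + ‖B i j‖ ^ 2) := add_sq_le
    _ = 2 * ‖A i j‖ ^ 2 + 2 * ‖B i j‖ ^ 2 := mul_add _ _ _

theorem hsNormSq_smul (c : ℂ) (A : Matrix m n ℂ) : hsNormSq (c • A) = ‖c‖ ^ 2 * hsNormSq A := by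
  simp only [hsNormSq, mul_sum, Matrix.smul_apply, smul_eq_mul, norm_mul, mul_pow]

theorem norm_apply_sq_le_hsNormSq (A : Matrix m n ℂ) (i : m) (j : n) :
    ‖A i j‖ ^ 2 ≤ hsNormSq A :=
  (single_le_sum (f := fun j => ‖A i j‖ ^ 2) (fun _ _ => by positivity) (mem_univ j)).trans
    (single_le_sum (f := fun i => ∑ j, ‖A i j‖ ^ 2) (fun _ _ => by positivity) (mem_univ i))

theorem hsNormSq_le_card_mul_card {A : Matrix m n ℂ} {s : ℝ} (hA : ∀ i j, ‖A i j‖ ≤ s) :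
    hsNormSq A ≤ Fintype.card m * Fintype.card n * s ^ 2 := by
  calc hsNormSq A ≤ ∑ _i : m, ∑ _j : n, s ^ 2 := by
        unfold hsNormSq; gcongr with i _ j _; exact hA i j
    _ = Fintype.card m * Fintype.card n * s ^ 2 := by
        simp only [sum_const, card_univ, nsmul_eq_mul, mul_assoc]

theorem hsNormSq_mul_le [DecidableEq n] (B : Matrix m n ℂ) (A : Matrix n p ℂ) :
    hsNormSq (B * A) ≤ ‖B‖ ^ 2 * hsNormSq A := by
  rw [← hsNormSq_transpose, ← hsNormSq_transpose A, hsNormSq, hsNormSq, mul_sum]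
  gcongr with j
  have h := pow_le_pow_left₀ (norm_nonneg _) (l2_opNorm_mulVec B (WithLp.toLp 2 (A.col j))) 2
  rw [mul_pow, EuclideanSpace.norm_sq_eq, EuclideanSpace.norm_sq_eq] at h
  exact h

theorem hsNormSq_mul_le_right [DecidableEq n] {B : Matrix m n ℂ} (hB : ‖B‖ ≤ 1)
    (A : Matrix n p ℂ) : hsNormSq (B * A) ≤ hsNormSq A :=
  (hsNormSq_mul_le B A).trans
    (mul_le_of_le_one_left (hsNormSq_nonneg A) (pow_le_one₀ (norm_nonneg B) hB))

theorem hsNormSq_mul_le_left [DecidableEq p] (A : Matrix m n ℂ) {B : Matrix n p ℂ}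
    (hB : ‖B‖ ≤ 1) : hsNormSq (A * B) ≤ hsNormSq A := by
  classical
  rw [← hsNormSq_conjTranspose, conjTranspose_mul, ← hsNormSq_conjTranspose A]
  exact hsNormSq_mul_le_right (by rwa [l2_opNorm_conjTranspose]) _

theorem hsNormSq_le_card [DecidableEq m] {T : Matrix m m ℂ} (hT : ‖T‖ ≤ 1) :
    hsNormSq T ≤ Fintype.card m := by
  simpa only [Matrix.mul_one, hsNormSq_one] using hsNormSq_mul_le_right hT (1 : Matrix m m ℂ)

theorem ofReal_hsNormSq (A : Matrix m n ℂ) : (hsNormSq A : ℂ) = trace (A * Aᴴ) := by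
  simp [hsNormSq, trace, Matrix.mul_apply, Complex.mul_conj, Complex.normSq_eq_norm_sq]

theorem hsNormSq_conjTranspose_mul_self (A : Matrix m n ℂ) :
    hsNormSq (Aᴴ * A) = hsNormSq (A * Aᴴ) := by
  have h : (hsNormSq (Aᴴ * A) : ℂ) = hsNormSq (A * Aᴴ) := by
    simp only [ofReal_hsNormSq, conjTranspose_mul, conjTranspose_conjTranspose]
    rw [Matrix.mul_assoc, trace_mul_comm]
    simp only [Matrix.mul_assoc]
  exact_mod_cast h

theorem norm_trace_mul_sq_le (A : Matrix m n ℂ) (B : Matrix n m ℂ) :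
    ‖trace (A * B)‖ ^ 2 ≤ hsNormSq A * hsNormSq B := by
  have h : ‖trace (A * B)‖ ≤ ∑ x : m × n, ‖A x.1 x.2‖ * ‖B x.2 x.1‖ := by
    simp only [Fintype.sum_prod_type, trace, diag_apply, Matrix.mul_apply, ← norm_mul]
    exact (norm_sum_le _ _).trans (sum_le_sum fun i _ => norm_sum_le _ _)
  refine (pow_le_pow_left₀ (norm_nonneg _) h 2).trans ?_
  refine (sum_mul_sq_le_sq_mul_sq _ _ _).trans (le_of_eq ?_)
  rw [← hsNormSq_transpose B]
  simp only [hsNormSq, Fintype.sum_prod_type, transpose_apply]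

theorem hsNormSq_mul_mul_self_le [DecidableEq m] (Y : Matrix m n ℂ) {T : Matrix n m ℂ}
    (hT : ‖T‖ ≤ 1) : hsNormSq (Y * T * Y) ≤ hsNormSq (Y * Yᴴ) := by
  classical
  have htrace : (hsNormSq (Y * T * Y) : ℂ) = trace ((Yᴴ * Y) * (T * (Y * Yᴴ) * Tᴴ)) := by
    rw [ofReal_hsNormSq, trace_mul_comm (Yᴴ * Y), Matrix.mul_assoc Y T Y, Matrix.mul_assoc Y,
      trace_mul_comm Y]
    simp only [conjTranspose_mul, Matrix.mul_assoc]
  have hcontract : hsNormSq (T * (Y * Yᴴ) * Tᴴ) ≤ hsNormSq (Y * Yᴴ) :=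
    (hsNormSq_mul_le_left _ (by rwa [l2_opNorm_conjTranspose])).trans (hsNormSq_mul_le_right hT _)
  refine le_of_sq_le_sq ?_ (hsNormSq_nonneg _)
  calc hsNormSq (Y * T * Y) ^ 2 = ‖trace ((Yᴴ * Y) * (T * (Y * Yᴴ) * Tᴴ))‖ ^ 2 := by
        rw [← htrace, Complex.norm_real, Real.norm_eq_abs, sq_abs]
    _ ≤ hsNormSq (Yᴴ * Y) * hsNormSq (T * (Y * Yᴴ) * Tᴴ) := norm_trace_mul_sq_le _ _
    _ ≤ hsNormSq (Y * Yᴴ) * hsNormSq (Y * Yᴴ) := by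
        rw [hsNormSq_conjTranspose_mul_self]
        gcongr
        exact hsNormSq_nonneg _
    _ = hsNormSq (Y * Yᴴ) ^ 2 := (sq _).symm

theorem hsNormSq_fromBlocks {m' n' : Type*} [Fintype m'] [Fintype n'] (A : Matrix m n ℂ)
    (B : Matrix m n' ℂ) (C : Matrix m' n ℂ) (D : Matrix m' n' ℂ) :
    hsNormSq (fromBlocks A B C D) = hsNormSq A + hsNormSq B + (hsNormSq C + hsNormSq D) := by
  simp only [hsNormSq, Fintype.sum_sum_type, sum_add_distrib, fromBlocks_apply₁₁,
    fromBlocks_apply₁₂, fromBlocks_apply₂₁, fromBlocks_apply₂₂]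
  ring

theorem hsNormSq_reindex {m' n' : Type*} [Fintype m'] [Fintype n'] (e : m ≃ m') (f : n ≃ n')
    (A : Matrix m n ℂ) : hsNormSq (reindex e f A) = hsNormSq A := by
  simp only [hsNormSq, reindex_apply, submatrix_apply]
  rw [e.symm.sum_comp fun i => ∑ j, ‖A i (f.symm j)‖ ^ 2]
  exact sum_congr rfl fun i _ => f.symm.sum_comp fun j => ‖A i j‖ ^ 2

end HilbertSchmidt

section Schur

theorem exists_unitary_conj_apply_succ_zero {n : ℕ} (A : Matrix (Fin (n + 1)) (Fin (n + 1)) ℂ) :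
    ∃ U ∈ unitaryGroup (Fin (n + 1)) ℂ, ∀ i : Fin n, (star U * A * U) i.succ 0 = 0 := by
  obtain ⟨μ, hμ⟩ := Module.End.exists_eigenvalue (toEuclideanLin A)
  obtain ⟨v, hv⟩ := hμ.exists_hasEigenvector
  obtain ⟨b, hb⟩ := Orthonormal.exists_orthonormalBasis_extension_of_card_eq (𝕜 := ℂ)
    (E := EuclideanSpace ℂ (Fin (n + 1))) (ι := Fin (n + 1)) (by simp)
    (v := fun _ => (‖v‖⁻¹ : ℂ) • v) (s := {0}) (by
      rw [orthonormal_iff_ite]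
      rintro ⟨i, rfl⟩ ⟨j, rfl⟩
      simp [Set.domRestrict, norm_smul, hv.2])
  let U : Matrix (Fin (n + 1)) (Fin (n + 1)) ℂ := of fun i j => b j i
  have hU : star U * U = 1 := by
    ext i j
    have := orthonormal_iff_ite.mp b.orthonormal i j
    rw [PiLp.inner_apply] at this
    simpa [U, Matrix.mul_apply, Matrix.one_apply, mul_comm] using this
  have hAU : ∀ x, (A * U) x 0 = μ * U x 0 := by
    intro x
    have hAb : toEuclideanLin A (b 0) = μ • b 0 := by
      rw [hb 0 rfl, map_smul, hv.apply_eq_smul, smul_comm]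
    exact congrArg (fun w : EuclideanSpace ℂ (Fin (n + 1)) => w x) hAb
  refine ⟨U, mem_unitaryGroup_iff'.mpr hU, fun i => ?_⟩
  calc (star U * A * U) i.succ 0 = ∑ x, star U i.succ x * (μ * U x 0) := by
        rw [Matrix.mul_assoc, Matrix.mul_apply]; simp only [hAU]
    _ = μ * (star U * U) i.succ 0 := by
        rw [Matrix.mul_apply, mul_sum]; exact sum_congr rfl fun x _ => by ring
    _ = 0 := by rw [hU, one_apply_ne (Fin.succ_ne_zero i), mul_zero]

theorem exists_unitary_conj_isUpperTriangular (n : ℕ) (A : Matrix (Fin n) (Fin n) ℂ) :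
    ∃ U ∈ unitaryGroup (Fin n) ℂ, (star U * A * U).IsUpperTriangular := by
  induction n with
  | zero => exact ⟨1, one_mem _, fun i => i.elim0⟩
  | succ n ih =>
    obtain ⟨U, hU, hcol⟩ := exists_unitary_conj_apply_succ_zero A
    set T := star U * A * U
    obtain ⟨V, hV, htri⟩ := ih (T.submatrix Fin.succ Fin.succ)
    let W : Matrix (Fin (n + 1)) (Fin (n + 1)) ℂ :=
      of (Fin.cons (Fin.cons 1 0) fun i => Fin.cons 0 (V i))
    have hW : star W * W = 1 := by
      ext i j
      have hVij : ∀ i j, ∑ x, (starRingEnd ℂ) (V x i) * V x j = if i = j then 1 else 0 :=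
        fun i j => congrFun (congrFun (mem_unitaryGroup_iff'.mp hV) i) j
      refine Fin.cases ?_ (fun i => ?_) i <;> refine Fin.cases ?_ (fun j => ?_) j <;>
        simp [W, Matrix.mul_apply, Fin.sum_univ_succ, Matrix.one_apply, hVij,
          (Fin.succ_ne_zero _).symm]
    refine ⟨U * W, mul_mem hU (mem_unitaryGroup_iff'.mpr hW), ?_⟩
    have hconj : star (U * W) * A * (U * W) = star W * T * W := by
      rw [star_mul]; simp only [T, Matrix.mul_assoc]
    rw [hconj]
    intro i j hij
    obtain ⟨i, rfl⟩ := Fin.exists_succ_eq.mpr (Fin.ne_zero_of_lt hij)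
    induction j using Fin.cases with
    | zero => simp [W, Matrix.mul_apply, Fin.sum_univ_succ, hcol]
    | succ j =>
      have hlower := htri (Fin.succ_lt_succ_iff.mp hij)
      simp only [Matrix.mul_apply, star_apply, submatrix_apply] at hlower
      simpa [W, Matrix.mul_apply, Fin.sum_univ_succ] using hlower

end Schur

section Spectrum

theorem aeval_apply_self_of_isUpperTriangular {n R : Type*} [Fintype n] [LinearOrder n]
    [CommRing R] {T : Matrix n n R} (hT : T.IsUpperTriangular) (p : R[X]) (i : n) :
    aeval T p i i = p.eval (T i i) := by
  induction p using Polynomial.induction_on' with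
  | add p q hp hq => rw [map_add, Matrix.add_apply, hp, hq, eval_add]
  | monomial k a =>
    rw [aeval_monomial, eval_monomial, ← Algebra.smul_def, Matrix.smul_apply, smul_eq_mul]
    congr 1
    induction k with
    | zero => simp
    | succ k ih =>
      rw [pow_succ, Matrix.mul_apply, sum_eq_single i, ih, pow_succ]
      · intro j _ hj
        rcases hj.lt_or_gt with h | h
        · rw [hT.pow k h, zero_mul]
        · rw [hT h, mul_zero]
      · simp

theorem isUpperTriangular_aeval {n R : Type*} [Fintype n] [LinearOrder n] [CommRing R]
    {T : Matrix n n R} (hT : T.IsUpperTriangular) (p : R[X]) : (aeval T p).IsUpperTriangular :=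
  Algebra.adjoin_le (S := blockTriangularSubalgebra R R id) (Set.singleton_subset_iff.mpr hT)
    (aeval_mem_adjoin_singleton R T)

theorem roots_charpoly_of_isUpperTriangular {n : Type*} [Fintype n] [LinearOrder n]
    {T : Matrix n n ℂ} (hT : T.IsUpperTriangular) :
    T.charpoly.roots = univ.val.map fun i => T i i := by
  have h := roots_multiset_prod_X_sub_C (univ.val.map fun i => T i i)
  rw [Multiset.map_map] at h
  rw [charpoly_of_isUpperTriangular T hT]
  exact h

theorem norm_le_one_of_mem_unitaryGroup {n : Type*} [Fintype n] [DecidableEq n]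
    {U : Matrix n n ℂ} (hU : U ∈ unitaryGroup n ℂ) : ‖U‖ ≤ 1 := by
  cases isEmpty_or_nonempty n
  · rw [Subsingleton.elim U 0, norm_zero]; exact zero_le_one
  · exact (CStarRing.norm_of_mem_unitary hU).le

theorem charpoly_unitary_conj {n : Type*} [Fintype n] [DecidableEq n] (A : Matrix n n ℂ)
    {U : Matrix n n ℂ} (hU : U ∈ unitaryGroup n ℂ) : (star U * A * U).charpoly = A.charpoly := by
  rw [charpoly_mul_comm, ← Matrix.mul_assoc, mem_unitaryGroup_iff.mp hU, Matrix.one_mul]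

variable {ι : Type*} [Fintype ι] [DecidableEq ι]

theorem roots_charpoly_aeval (A : Matrix ι ι ℂ) (p : ℂ[X]) :
    (aeval A p).charpoly.roots = A.charpoly.roots.map p.eval := by
  let e := reindexAlgEquiv ℂ ℂ (Fintype.equivFin ι)
  obtain ⟨U, hU, hT⟩ := exists_unitary_conj_isUpperTriangular _ (e A)
  have haeval : star U * e (aeval A p) * U = aeval (star U * e A * U) p := by
    have h := aeval_algHom_apply
      (Unitary.conjStarAlgAut ℂ _ (star ⟨U, hU⟩ : unitaryGroup _ ℂ)).toAlgEquiv (e A) p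
    simp only [aeval_algHom_apply e] at h ⊢
    simpa [Unitary.conjStarAlgAut_apply] using h.symm
  have hroots : ∀ B : Matrix ι ι ℂ, B.charpoly.roots = (star U * e B * U).charpoly.roots :=
    fun B => by rw [charpoly_unitary_conj _ hU]; exact congrArg roots (charpoly_reindex _ B).symm
  rw [hroots, hroots A, haeval, roots_charpoly_of_isUpperTriangular (isUpperTriangular_aeval hT p),
    roots_charpoly_of_isUpperTriangular hT, Multiset.map_map]
  exact Multiset.map_congr rfl fun i _ => aeval_apply_self_of_isUpperTriangular hT p i

theorem sum_norm_sq_roots_charpoly_le (A : Matrix ι ι ℂ) :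
    (A.charpoly.roots.map (‖·‖ ^ 2)).sum ≤ hsNormSq A := by
  let e := Fintype.equivFin ι
  obtain ⟨U, hU, hT⟩ := exists_unitary_conj_isUpperTriangular _ (reindex e e A)
  have hnorm : ‖U‖ ≤ 1 := norm_le_one_of_mem_unitaryGroup hU
  have hroots : A.charpoly.roots = univ.val.map fun i => (star U * reindex e e A * U) i i := by
    rw [← charpoly_reindex e, ← charpoly_unitary_conj _ hU, roots_charpoly_of_isUpperTriangular hT]
  calc (A.charpoly.roots.map (‖·‖ ^ 2)).sum
      = ∑ i, ‖(star U * reindex e e A * U) i i‖ ^ 2 := by rw [hroots, Multiset.map_map]; rfl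
    _ ≤ hsNormSq (star U * reindex e e A * U) :=
        sum_le_sum fun i _ => single_le_sum (f := fun j => ‖_‖ ^ 2) (fun _ _ => by positivity)
          (mem_univ i)
    _ ≤ hsNormSq (reindex e e A) := (hsNormSq_mul_le_left _ hnorm).trans
        (hsNormSq_mul_le_right (by rwa [norm_star]) _)
    _ = hsNormSq A := hsNormSq_reindex e e A

theorem sum_norm_sq_roots_charpoly_mul_comm {κ : Type*} [Fintype κ] [DecidableEq κ]
    (A : Matrix ι κ ℂ) (B : Matrix κ ι ℂ) (h : Fintype.card ι ≤ Fintype.card κ) :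
    ((A * B).charpoly.roots.map (‖·‖ ^ 2)).sum = ((B * A).charpoly.roots.map (‖·‖ ^ 2)).sum := by
  rw [charpoly_mul_comm_of_le B A h, roots_mul (mul_ne_zero (pow_ne_zero _ X_ne_zero)
    (charpoly_monic _).ne_zero), roots_X_pow, Multiset.map_add, Multiset.sum_add,
    Multiset.map_nsmul, Multiset.sum_nsmul]
  simp

/-- With `R = S - Q S`, the nonzero eigenvalues of `S = [Q, t] [S; t⁻¹ R]` are those of the block
matrix `[S; t⁻¹ R] [Q, t]`, to which Schur's inequality applies. -/
theorem sum_norm_sq_roots_charpoly_le_of_approx (S : Matrix ι ι ℂ) {Q : Matrix ι ι ℂ}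
    (hQ : ‖Q‖ ≤ 1) {t : ℝ} (ht : 0 < t) :
    (S.charpoly.roots.map (‖·‖ ^ 2)).sum ≤
      hsNormSq (S * Q) + t ^ 2 * hsNormSq S + (t⁻¹ ^ 2 + 1) * hsNormSq (S - Q * S) := by
  set R := S - Q * S with hR
  have ht' : (t : ℂ) ≠ 0 := by exact_mod_cast ht.ne'
  let V := fromCols Q ((t : ℂ) • (1 : Matrix ι ι ℂ))
  let W := fromRows S ((t : ℂ)⁻¹ • R)
  have hVW : V * W = S := by
    rw [fromCols_mul_fromRows, smul_mul_smul_comm, mul_inv_cancel₀ ht', one_smul, Matrix.one_mul,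
      hR, add_sub_cancel]
  have hWV : W * V = fromBlocks (S * Q) ((t : ℂ) • S) ((t : ℂ)⁻¹ • (R * Q)) R := by
    rw [fromRows_mul_fromCols, Matrix.mul_smul, Matrix.mul_one, Matrix.smul_mul,
      smul_mul_smul_comm, inv_mul_cancel₀ ht', one_smul, Matrix.mul_one]
  calc (S.charpoly.roots.map (‖·‖ ^ 2)).sum = ((W * V).charpoly.roots.map (‖·‖ ^ 2)).sum := by
        rw [← sum_norm_sq_roots_charpoly_mul_comm V W (by simp), hVW]
    _ ≤ hsNormSq (W * V) := sum_norm_sq_roots_charpoly_le _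
    _ = hsNormSq (S * Q) + t ^ 2 * hsNormSq S + (t⁻¹ ^ 2 * hsNormSq (R * Q) + hsNormSq R) := by
        rw [hWV, hsNormSq_fromBlocks, hsNormSq_smul, hsNormSq_smul, norm_inv, Complex.norm_real,
          Real.norm_of_nonneg ht.le]
    _ ≤ hsNormSq (S * Q) + t ^ 2 * hsNormSq S + (t⁻¹ ^ 2 * hsNormSq R + hsNormSq R) := by
        gcongr; exact hsNormSq_mul_le_left R hQ
    _ = _ := by ring

end Spectrum

section Jensen

theorem mahlerMeasure_le_of_norm_eval_le {p : ℂ[X]} {K : ℝ} (hK : 1 ≤ K)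
    (h : ∀ z : ℂ, ‖z‖ = 1 → ‖p.eval z‖ ≤ K) : p.mahlerMeasure ≤ K := by
  rcases eq_or_ne p 0 with rfl | hp
  · rw [mahlerMeasure_zero]; linarith
  rw [mahlerMeasure_def_of_ne_zero hp, ← Real.le_log_iff_exp_le (by linarith)]
  have hlog : ∫ x in (0 : ℝ)..(2 * Real.pi), Real.log ‖eval (circleMap 0 1 x) p‖ ≤
      ∫ _ in (0 : ℝ)..(2 * Real.pi), Real.log K := by
    refine intervalIntegral.integral_mono_on (by positivity) p.intervalIntegrable_mahlerMeasure
      (by simp) fun x _ => ?_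
    rcases (norm_nonneg (eval (circleMap 0 1 x) p)).eq_or_lt with h0 | h0
    · rw [← h0, Real.log_zero]; exact Real.log_nonneg hK
    · exact Real.log_le_log h0 (h _ (by simp))
  rw [intervalIntegral.integral_const, smul_eq_mul, sub_zero] at hlog
  calc _ ≤ (2 * Real.pi)⁻¹ * (2 * Real.pi * Real.log K) := by gcongr
    _ = Real.log K := by field_simp

variable {ι : Type*} [Fintype ι] [DecidableEq ι]

theorem norm_det_le_prod_sum_norm (A : Matrix ι ι ℂ) : ‖A.det‖ ≤ ∏ j, ∑ i, ‖A i j‖ := by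
  rw [prod_univ_sum, det_apply', Fintype.piFinset_univ]
  calc _ ≤ ∑ σ : Equiv.Perm ι, ∏ j, ‖A (σ j) j‖ := by
        refine (norm_sum_le _ _).trans (sum_le_sum fun σ _ => ?_)
        rcases Int.units_eq_one_or (Equiv.Perm.sign σ) with h | h <;> simp [h, norm_prod]
    _ = ∑ f ∈ univ.map ⟨fun σ : Equiv.Perm ι => (σ : ι → ι), DFunLike.coe_injective⟩,
          ∏ j, ‖A (f j) j‖ := by rw [sum_map]; rfl
    _ ≤ ∑ f : ι → ι, ∏ j, ‖A (f j) j‖ :=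
        sum_le_sum_of_subset_of_nonneg (subset_univ _) fun _ _ _ => by positivity

theorem mahlerMeasure_charpoly_le (T : Matrix ι ι ℂ) :
    T.charpoly.mahlerMeasure ≤ ∏ j, (1 + ∑ i, ‖T i j‖) := by
  refine mahlerMeasure_le_of_norm_eval_le
    (Finset.one_le_prod fun j _ => le_add_of_nonneg_right (by positivity)) fun z hz => ?_
  rw [Matrix.eval_charpoly]
  refine (norm_det_le_prod_sum_norm _).trans
    (prod_le_prod (fun j _ => by positivity) fun j _ => ?_)
  calc ∑ i, ‖(Matrix.scalar ι z - T) i j‖ ≤ ∑ i, ((if i = j then 1 else 0) + ‖T i j‖) := by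
        refine sum_le_sum fun i _ => (norm_sub_le _ _).trans ?_
        gcongr
        by_cases hij : i = j <;> simp [hij, hz]
    _ = 1 + ∑ i, ‖T i j‖ := by rw [sum_add_distrib]; simp

theorem pow_card_roots_filter_le_mahlerMeasure {p : ℂ[X]} (hp : p.Monic) {R : ℝ} (hR : 0 ≤ R) :
    R ^ (p.roots.filter (R ≤ ‖·‖)).card ≤ p.mahlerMeasure := by
  rw [mahlerMeasure_eq_leadingCoeff_mul_prod_roots, hp.leadingCoeff, norm_one, one_mul]
  generalize p.roots = s
  induction s using Multiset.induction with
  | empty => simp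
  | cons z s ih =>
    rw [Multiset.map_cons, Multiset.prod_cons]
    by_cases hz : R ≤ ‖z‖
    · rw [Multiset.filter_cons_of_pos (p := fun z : ℂ => R ≤ ‖z‖) s hz, Multiset.card_cons,
        pow_succ']
      exact mul_le_mul (hz.trans (le_max_right _ _)) ih (by positivity) (by positivity)
    · rw [Multiset.filter_cons_of_neg (p := fun z : ℂ => R ≤ ‖z‖) s hz]
      exact ih.trans (le_mul_of_one_le_left ((pow_nonneg hR _).trans ih) (le_max_left _ _))

theorem card_roots_charpoly_smul_filter (T : Matrix ι ι ℂ) {s : ℝ} (hs : 0 < s) (r : ℝ) :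
    (((s : ℂ) • T).charpoly.roots.filter (s * r ≤ ‖·‖)).card =
      (T.charpoly.roots.filter (r ≤ ‖·‖)).card := by
  have haeval : aeval T (C (s : ℂ) * X) = (s : ℂ) • T := by
    rw [map_mul, aeval_C, aeval_X, Algebra.smul_def]
  rw [← haeval, roots_charpoly_aeval, Multiset.filter_map, Multiset.card_map]
  congr 2
  ext z
  simp only [Function.comp_apply, eval_mul, eval_C, eval_X, norm_mul, Complex.norm_real,
    Real.norm_of_nonneg hs.le, mul_le_mul_iff_right₀ hs]

theorem prod_one_add_le_pow_mul_exp {κ : Type*} [Fintype κ] {f : κ → ℝ} (hf : ∀ j, 0 ≤ f j)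
    {a b : ℝ} (X : Finset κ) (hX : ∀ j ∈ X, 1 + f j ≤ b)
    (hXc : ∀ j ∉ X, f j ≤ a / Fintype.card κ) (ha : 0 ≤ a) :
    ∏ j, (1 + f j) ≤ b ^ #X * Real.exp a := by
  classical
  have hf1 : ∀ j, 0 ≤ 1 + f j := fun j => add_nonneg zero_le_one (hf j)
  have hin : ∏ j ∈ X, (1 + f j) ≤ b ^ #X := by
    rw [← prod_const]; exact prod_le_prod (fun j _ => hf1 j) hX
  have hout : ∏ j ∈ Xᶜ, (1 + f j) ≤ Real.exp a := by
    calc _ ≤ ∏ j ∈ Xᶜ, Real.exp (f j) := prod_le_prod (fun j _ => hf1 j) fun j _ => by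
          rw [add_comm]; exact Real.add_one_le_exp (f j)
      _ = Real.exp (∑ j ∈ Xᶜ, f j) := (Real.exp_sum _ _).symm
      _ ≤ Real.exp a := by
          gcongr
          calc ∑ j ∈ Xᶜ, f j ≤ ∑ _j ∈ Xᶜ, a / Fintype.card κ := sum_le_sum fun j hj =>
                hXc j (mem_compl.mp hj)
            _ = #Xᶜ / Fintype.card κ * a := by rw [sum_const, nsmul_eq_mul]; ring
            _ ≤ a := mul_le_of_le_one_left ha (div_le_one_of_le₀
                (by exact_mod_cast card_le_univ _) (by positivity))
  rw [← prod_mul_prod_compl X]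
  exact mul_le_mul hin hout (prod_nonneg fun j _ => hf1 j)
    ((prod_nonneg fun j _ => hf1 j).trans hin)

/-- Jensen's formula for the characteristic polynomial on the circle of radius `x ^ (-2 ν)`. -/
theorem card_roots_charpoly_filter_mul_log_le {T : Matrix ι ι ℂ} (hT : ∀ i j, ‖T i j‖ ≤ 1)
    {x ν a : ℝ} (hx : (Fintype.card ι : ℝ) = x) (hx2 : 2 ≤ x) (hν : 0 < ν) (ha : 0 ≤ a)
    (X : Finset ι) (hX : ∀ j ∉ X, ∀ i, ‖T i j‖ ≤ a * x ^ (-(2 + 2 * ν))) :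
    (T.charpoly.roots.filter (x ^ (-ν) ≤ ‖·‖)).card * (ν * Real.log x) ≤
      #X * ((2 + 2 * ν) * Real.log x) + a := by
  have hx0 : 0 < x := by linarith
  have hs : 0 < x ^ (2 * ν) := by positivity
  have hsum : ∀ j {b : ℝ}, (∀ i, ‖T i j‖ ≤ b) →
      ∑ i, ‖((x ^ (2 * ν) : ℝ) • T) i j‖ ≤ x ^ (2 * ν) * (x * b) := by
    intro j b hb
    calc _ = x ^ (2 * ν) * ∑ i, ‖T i j‖ := by
          simp only [Matrix.smul_apply, norm_smul, Real.norm_of_nonneg hs.le, mul_sum]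
      _ ≤ x ^ (2 * ν) * ∑ _i : ι, b := by gcongr with i; exact hb i
      _ = _ := by rw [sum_const, card_univ, nsmul_eq_mul, hx]
  have hin : ∀ j ∈ X, 1 + ∑ i, ‖((x ^ (2 * ν) : ℝ) • T) i j‖ ≤ x ^ (2 + 2 * ν) := by
    intro j _
    have h1 : 1 ≤ x ^ (2 * ν) * x :=
      one_le_mul_of_one_le_of_one_le (Real.one_le_rpow (by linarith) (by positivity)) (by linarith)
    have h2 : x ^ (2 + 2 * ν) = x ^ (2 * ν) * x * x := by
      rw [Real.rpow_add hx0, Real.rpow_two]; ring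
    nlinarith [hsum j fun i => hT i j]
  have hout : ∀ j ∉ X, ∑ i, ‖((x ^ (2 * ν) : ℝ) • T) i j‖ ≤ a / Fintype.card ι := by
    intro j hj
    refine (hsum j (hX j hj)).trans (le_of_eq ?_)
    rw [hx, neg_add, Real.rpow_add hx0, Real.rpow_neg hx0.le (2 * ν), Real.rpow_neg hx0.le,
      Real.rpow_two]
    field_simp
  have hjensen := (pow_card_roots_filter_le_mahlerMeasure (charpoly_monic _) (R := x ^ ν)
    (by positivity)).trans ((mahlerMeasure_charpoly_le ((x ^ (2 * ν) : ℝ) • T)).trans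
      (prod_one_add_le_pow_mul_exp (fun _ => by positivity) X hin hout ha))
  have hscale : x ^ ν = x ^ (2 * ν) * x ^ (-ν) := by rw [← Real.rpow_add hx0]; ring_nf
  have hcard := card_roots_charpoly_smul_filter T hs (x ^ (-ν))
  rw [← hscale, Complex.coe_smul] at hcard
  have hlog := Real.log_le_log (by positivity) hjensen
  rwa [hcard, Real.log_mul (by positivity) (by positivity), Real.log_exp, Real.log_pow,
    Real.log_pow, Real.log_rpow hx0, Real.log_rpow hx0] at hlog

end Jensen

section AddEnergy

theorem card_filter_swap_product {α β : Type*} (s : Finset α) (t : Finset β)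
    (p : α × β → Prop) [DecidablePred p] :
    #{q ∈ t ×ˢ s | p q.swap} = #{q ∈ s ×ˢ t | p q} := by
  refine card_equiv (Equiv.prodComm β α) fun q => ?_
  simp [and_comm, and_assoc]

variable {G : Type*} [AddCommGroup G] [DecidableEq G] (S : Finset G)

section Fintype

variable [Fintype G]

theorem card_filter_add_eq_add_add (m : G) :
    #{x ∈ (S ×ˢ S) ×ˢ S ×ˢ S | x.1.1 + x.2.1 = x.1.2 + x.2.2 + m} =
      ∑ d, #{p ∈ S ×ˢ S | p.1 - p.2 = d} * #{p ∈ S ×ˢ S | p.1 - p.2 = d - m} := by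
  rw [card_eq_sum_card_fiberwise (f := fun x => x.1.1 - x.1.2) (t := univ) (by simp)]
  refine sum_congr rfl fun d _ => ?_
  rw [← card_filter_swap_product S S fun p => p.1 - p.2 = d - m, ← card_product,
    ← filter_product, filter_filter]
  refine congrArg card (filter_congr fun x _ => ?_)
  simp only [Prod.fst_swap, Prod.snd_swap]
  rw [and_comm]
  refine and_congr_right fun h => ?_
  rw [← h, sub_sub, sub_eq_sub_iff_add_eq_add, ← add_assoc, add_comm x.2.2, eq_comm]

theorem addEnergy_eq_sum_card_sub_sq :
    S.addEnergy S = ∑ d, #{p ∈ S ×ˢ S | p.1 - p.2 = d} ^ 2 := by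
  simpa only [addEnergy, add_zero, sub_zero, ← sq] using card_filter_add_eq_add_add S 0

theorem sum_sub_eq_sum_card_mul {E : Type*} [NonAssocSemiring E] (g : G → E) :
    ∑ x ∈ S, ∑ x' ∈ S, g (x - x') = ∑ d, (#{p ∈ S ×ˢ S | p.1 - p.2 = d} : E) * g d := by
  rw [← sum_product', ← sum_fiberwise_of_maps_to (g := fun p => p.1 - p.2) (t := univ) (by simp)]
  refine sum_congr rfl fun d _ => ?_
  rw [← nsmul_eq_mul, ← sum_const]
  exact sum_congr rfl fun p hp => by rw [(mem_filter.mp hp).2]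

end Fintype

theorem card_filter_add_eq_add_add_le_addEnergy [Finite G] (m : G) :
    #{x ∈ (S ×ˢ S) ×ˢ S ×ˢ S | x.1.1 + x.2.1 = x.1.2 + x.2.2 + m} ≤ S.addEnergy S := by
  have := Fintype.ofFinite G
  set r : G → ℕ := fun d => #{p ∈ S ×ˢ S | p.1 - p.2 = d}
  have hr : ∑ d, r (d - m) ^ 2 = ∑ d, r d ^ 2 := Equiv.sum_comp (Equiv.subRight m) (r · ^ 2)
  have hamgm : ∑ d, 2 * (r d * r (d - m)) ≤ ∑ d, (r d ^ 2 + r (d - m) ^ 2) :=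
    sum_le_sum fun d _ => by rw [← mul_assoc]; exact two_mul_le_add_sq _ _
  rw [← mul_sum, sum_add_distrib, hr, ← two_mul] at hamgm
  rw [card_filter_add_eq_add_add, addEnergy_eq_sum_card_sub_sq]
  exact Nat.le_of_mul_le_mul_left hamgm two_pos

end AddEnergy

section CrossSum

open ComplexConjugate

theorem ofReal_norm_sum_sq {α : Type*} (s : Finset α) (f : α → ℂ) :
    ((‖∑ y ∈ s, f y‖ ^ 2 : ℝ) : ℂ) = ∑ y ∈ s, ∑ y' ∈ s, f y * conj (f y') := by
  rw [Complex.ofReal_pow, ← Complex.mul_conj', map_sum, sum_mul_sum]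

theorem sum_le_sum_sum_add_of_subset_add {G : Type*} [AddCommGroup G] [DecidableEq G]
    {X S J : Finset G} (h : X ⊆ S + J) {f : G → ℝ} (hf : ∀ x, 0 ≤ f x) :
    ∑ x ∈ X, f x ≤ ∑ j ∈ J, ∑ s ∈ S, f (s + j) := by
  have hmaps : ∀ p ∈ S ×ˢ J, p.1 + p.2 ∈ S + J := fun p hp =>
    add_mem_add (mem_product.mp hp).1 (mem_product.mp hp).2
  calc ∑ x ∈ X, f x ≤ ∑ x ∈ S + J, f x := sum_le_sum_of_subset_of_nonneg h fun x _ _ => hf x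
    _ ≤ ∑ x ∈ S + J, ∑ p ∈ S ×ˢ J with p.1 + p.2 = x, f (p.1 + p.2) := by
        refine sum_le_sum fun x hx => ?_
        obtain ⟨s, hs, j, hj, rfl⟩ := mem_add.mp hx
        exact single_le_sum (f := fun p : G × G => f (p.1 + p.2)) (a := (s, j))
          (fun p _ => hf _) (by simp [hs, hj])
    _ = ∑ j ∈ J, ∑ s ∈ S, f (s + j) := by
        rw [sum_fiberwise_of_maps_to hmaps, sum_product_right]

variable {R : Type*} [CommRing R]

/-- For the matrix `W` with entries `ψ (x y)`, `x ∈ S`, `y ∈ T`, the squared Hilbert–Schmidt norm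
of `W * Wᴴ`. -/
noncomputable def crossSum (ψ : AddChar R ℂ) (S T : Finset R) : ℝ :=
  ∑ x ∈ S, ∑ x' ∈ S, ‖∑ y ∈ T, ψ (y * (x - x'))‖ ^ 2

variable (ψ : AddChar R ℂ) (S T : Finset R)

theorem crossSum_nonneg : 0 ≤ crossSum ψ S T := by unfold crossSum; positivity

section Finite

variable [Finite R]

theorem mul_addChar_mul_conj (u v : ℂ) (a b : R) :
    u * ψ a * conj (v * ψ b) = u * conj v * ψ (a - b) := by
  rw [map_mul (starRingEnd ℂ), ← AddChar.map_neg_eq_conj, mul_mul_mul_comm,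
    ← AddChar.map_add_eq_mul, sub_eq_add_neg]

theorem ofReal_norm_sum_addChar_sq (z : R) :
    ((‖∑ y ∈ T, ψ (y * z)‖ ^ 2 : ℝ) : ℂ) = ∑ y ∈ T, ∑ y' ∈ T, ψ ((y - y') * z) := by
  rw [ofReal_norm_sum_sq]
  simp only [← AddChar.map_neg_eq_conj, ← AddChar.map_add_eq_mul]
  simp only [← sub_eq_add_neg, ← sub_mul]

theorem ofReal_sum_sum_norm_weighted_sq (w : R → ℂ) :
    ((∑ x ∈ S, ∑ x' ∈ S, ‖∑ y ∈ T, w y * ψ (y * (x - x'))‖ ^ 2 : ℝ) : ℂ) =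
      ∑ y ∈ T, ∑ y' ∈ T, w y * conj (w y') * ((‖∑ x ∈ S, ψ (x * (y - y'))‖ ^ 2 : ℝ) : ℂ) := by
  simp only [ofReal_norm_sum_addChar_sq]
  simp only [Complex.ofReal_sum, ofReal_norm_sum_sq, mul_sum]
  have hterm : ∀ x x' y y' : R, w y * ψ (y * (x - x')) * conj (w y' * ψ (y' * (x - x'))) =
      w y * conj (w y') * ψ ((x - x') * (y - y')) := fun x x' y y' => by
    rw [mul_addChar_mul_conj, ← sub_mul, mul_comm (y - y')]
  simp only [hterm]
  calc _ = ∑ x ∈ S, ∑ y ∈ T, ∑ x' ∈ S, ∑ y' ∈ T,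
        w y * conj (w y') * ψ ((x - x') * (y - y')) := sum_congr rfl fun x _ => sum_comm
    _ = ∑ y ∈ T, ∑ x ∈ S, ∑ x' ∈ S, ∑ y' ∈ T,
        w y * conj (w y') * ψ ((x - x') * (y - y')) := sum_comm
    _ = ∑ y ∈ T, ∑ x ∈ S, ∑ y' ∈ T, ∑ x' ∈ S,
        w y * conj (w y') * ψ ((x - x') * (y - y')) :=
      sum_congr rfl fun y _ => sum_congr rfl fun x _ => sum_comm
    _ = _ := sum_congr rfl fun y _ => sum_comm

theorem crossSum_comm : crossSum ψ S T = crossSum ψ T S := by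
  have h := ofReal_sum_sum_norm_weighted_sq ψ S T 1
  simp only [Pi.one_apply, map_one, one_mul, ← Complex.ofReal_sum] at h
  exact_mod_cast h

theorem sum_sum_norm_weighted_sq_le_crossSum {w : R → ℂ} (hw : ∀ y, ‖w y‖ ≤ 1) :
    ∑ x ∈ S, ∑ x' ∈ S, ‖∑ y ∈ T, w y * ψ (y * (x - x'))‖ ^ 2 ≤ crossSum ψ S T := by
  rw [crossSum_comm]
  calc _ = ‖((∑ x ∈ S, ∑ x' ∈ S, ‖∑ y ∈ T, w y * ψ (y * (x - x'))‖ ^ 2 : ℝ) : ℂ)‖ := by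
        rw [Complex.norm_real, Real.norm_of_nonneg (by positivity)]
    _ ≤ crossSum ψ T S := by
        rw [ofReal_sum_sum_norm_weighted_sq]
        refine (norm_sum_le _ _).trans (sum_le_sum fun y _ => (norm_sum_le _ _).trans
          (sum_le_sum fun y' _ => ?_))
        rw [norm_mul, norm_mul, RCLike.norm_conj, Complex.norm_real, Real.norm_of_nonneg
          (sq_nonneg _)]
        exact mul_le_of_le_one_left (sq_nonneg _) (mul_le_one₀ (hw y) (norm_nonneg _) (hw y'))

theorem crossSum_le_of_subset_add [DecidableEq R] {X J : Finset R} (hX : X ⊆ S + J) :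
    crossSum ψ X T ≤ (#J : ℝ) ^ 2 * crossSum ψ S T := by
  have hshift : ∀ j j' : R,
      ∑ s ∈ S, ∑ s' ∈ S, ‖∑ y ∈ T, ψ (y * (s + j - (s' + j')))‖ ^ 2 ≤ crossSum ψ S T := by
    intro j j'
    refine le_of_eq_of_le (sum_congr rfl fun s _ => sum_congr rfl fun s' _ => ?_)
      (sum_sum_norm_weighted_sq_le_crossSum ψ S T (w := fun y => ψ (y * (j - j')))
        fun y => (ψ.norm_apply _).le)
    refine congrArg (‖·‖ ^ 2) (sum_congr rfl fun y _ => ?_)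
    rw [add_sub_add_comm, mul_add, AddChar.map_add_eq_mul, mul_comm (ψ _)]
  calc crossSum ψ X T
      ≤ ∑ j ∈ J, ∑ s ∈ S, ∑ x' ∈ X, ‖∑ y ∈ T, ψ (y * (s + j - x'))‖ ^ 2 :=
        sum_le_sum_sum_add_of_subset_add hX fun _ => by positivity
    _ ≤ ∑ j ∈ J, ∑ s ∈ S, ∑ j' ∈ J, ∑ s' ∈ S, ‖∑ y ∈ T, ψ (y * (s + j - (s' + j')))‖ ^ 2 :=
        sum_le_sum fun j _ => sum_le_sum fun s _ =>
          sum_le_sum_sum_add_of_subset_add (f := fun x' => ‖∑ y ∈ T, ψ (y * (s + j - x'))‖ ^ 2) hX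
            fun _ => by positivity
    _ = ∑ j ∈ J, ∑ j' ∈ J, ∑ s ∈ S, ∑ s' ∈ S, ‖∑ y ∈ T, ψ (y * (s + j - (s' + j')))‖ ^ 2 :=
        sum_congr rfl fun j _ => sum_comm
    _ ≤ ∑ _j ∈ J, ∑ _j' ∈ J, crossSum ψ S T :=
        sum_le_sum fun j _ => sum_le_sum fun j' _ => hshift j j'
    _ = _ := by simp only [sum_const, nsmul_eq_mul]; ring

theorem crossSum_le_of_subset_add_of_subset_add [DecidableEq R] {X Y J K : Finset R}
    (hX : X ⊆ S + J) (hY : Y ⊆ T + K) :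
    crossSum ψ X Y ≤ (#J * #K : ℝ) ^ 2 * crossSum ψ S T :=
  calc crossSum ψ X Y ≤ (#J : ℝ) ^ 2 * crossSum ψ Y S := by
        rw [crossSum_comm ψ Y]; exact crossSum_le_of_subset_add ψ S Y hX
    _ ≤ (#J : ℝ) ^ 2 * ((#K : ℝ) ^ 2 * crossSum ψ S T) := by
        rw [crossSum_comm ψ S]; gcongr; exact crossSum_le_of_subset_add ψ T S hY
    _ = _ := by ring

end Finite

variable [Fintype R]

theorem sum_norm_sum_mul_sq {ψ : AddChar R ℂ} (hψ : ψ.IsPrimitive) (f : R → ℂ) :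
    ∑ z, ‖∑ c, f c * ψ (c * z)‖ ^ 2 = Fintype.card R * ∑ c, ‖f c‖ ^ 2 := by
  classical
  have hterm : ∀ z c c' : R, f c * ψ (c * z) * conj (f c' * ψ (c' * z)) =
      f c * conj (f c') * ψ (z * (c - c')) := fun z c c' => by
    rw [mul_addChar_mul_conj, ← sub_mul, mul_comm z]
  have h : ((∑ z, ‖∑ c, f c * ψ (c * z)‖ ^ 2 : ℝ) : ℂ) =
      ((Fintype.card R * ∑ c, ‖f c‖ ^ 2 : ℝ) : ℂ) := by
    calc _ = ∑ z, ∑ c, ∑ c', f c * conj (f c') * ψ (z * (c - c')) := by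
          simp only [Complex.ofReal_sum, ofReal_norm_sum_sq, hterm]
      _ = ∑ c, ∑ z, ∑ c', f c * conj (f c') * ψ (z * (c - c')) := sum_comm
      _ = ∑ c, ∑ c', f c * conj (f c') * ∑ z, ψ (z * (c - c')) := by
          simp only [mul_sum]; exact sum_congr rfl fun c _ => sum_comm
      _ = ∑ c, f c * conj (f c) * Fintype.card R := by
          simp only [AddChar.sum_mulShift _ hψ, sub_eq_zero, apply_ite Nat.cast, Nat.cast_zero,
            mul_ite, mul_zero, sum_ite_eq, mem_univ, if_true]
      _ = _ := by
          rw [← sum_mul, mul_comm]; simp only [Complex.mul_conj']; push_cast; rfl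
  exact_mod_cast h

/-- Cauchy–Schwarz over the common difference `x - x'`, then Parseval in the dual variable. -/
theorem crossSum_sq_le [DecidableEq R] {ψ : AddChar R ℂ} (hψ : ψ.IsPrimitive) :
    crossSum ψ S T ^ 2 ≤ Fintype.card R * S.addEnergy S * T.addEnergy T := by
  set g : R → ℝ := fun d => ‖∑ y ∈ T, ψ (y * d)‖ ^ 2
  have hfourth : ∑ d, g d ^ 2 = Fintype.card R * T.addEnergy T := by
    have h := sum_norm_sum_mul_sq hψ fun c => (#{p ∈ T ×ˢ T | p.1 - p.2 = c} : ℂ)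
    simp only [← sum_sub_eq_sum_card_mul T fun c => ψ (c * _), ← ofReal_norm_sum_addChar_sq,
      Complex.norm_real, Real.norm_of_nonneg (sq_nonneg _), Complex.norm_natCast] at h
    rw [h, addEnergy_eq_sum_card_sub_sq]
    push_cast
    rfl
  calc crossSum ψ S T ^ 2 = (∑ d, (#{p ∈ S ×ˢ S | p.1 - p.2 = d} : ℝ) * g d) ^ 2 := by
        rw [← sum_sub_eq_sum_card_mul]; rfl
    _ ≤ (∑ d, (#{p ∈ S ×ˢ S | p.1 - p.2 = d} : ℝ) ^ 2) * ∑ d, g d ^ 2 :=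
        sum_mul_sq_le_sq_mul_sq _ _ _
    _ = _ := by rw [hfourth, addEnergy_eq_sum_card_sub_sq S]; push_cast; ring

end CrossSum

section Cantor

variable {M : ℕ} (A : Finset (Fin M))

/-- The numbers in `{0, …, M ^ k - 1}` all of whose `k` base-`M` digits lie in `A`: the standard
representatives of `cantorSet M A k`. -/
noncomputable def cantorNat (k : ℕ) : Finset ℕ :=
  (Fintype.piFinset fun _ : Fin k => A).image fun a => ∑ i : Fin k, (a i : ℕ) * M ^ (i : ℕ)

theorem cantorSet_eq_image_cantorNat (k : ℕ) :
    cantorSet M A k = (cantorNat A k).image Nat.cast := by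
  rw [cantorSet, cantorNat, image_image]; rfl

theorem injective_sum_digits_mul_pow (k : ℕ) :
    Function.Injective fun a : Fin k → Fin M => ∑ i, (a i : ℕ) * M ^ (i : ℕ) := fun a b h =>
  finFunctionFinEquiv.injective (Fin.ext (by simpa only [finFunctionFinEquiv_apply] using h))

variable {A}

theorem lt_pow_of_mem_cantorNat {k x : ℕ} (hx : x ∈ cantorNat A k) : x < M ^ k := by
  obtain ⟨a, -, rfl⟩ := mem_image.mp hx
  exact (finFunctionFinEquiv_apply a).symm.trans_lt (finFunctionFinEquiv a).isLt

variable (A)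

theorem card_cantorNat (k : ℕ) : #(cantorNat A k) = #A ^ k := by
  rw [cantorNat, card_image_of_injective _ (injective_sum_digits_mul_pow k), Fintype.card_piFinset,
    prod_const, card_univ, Fintype.card_fin]

theorem mem_cantorNat_add {j k z : ℕ} :
    z ∈ cantorNat A (j + k) ↔
      ∃ x ∈ cantorNat A j, ∃ y ∈ cantorNat A k, x + M ^ j * y = z := by
  have hsum : ∀ (a : Fin j → Fin M) (b : Fin k → Fin M),
      ∑ i : Fin (j + k), ((Fin.append a b i : Fin M) : ℕ) * M ^ (i : ℕ) =
        ∑ i, (a i : ℕ) * M ^ (i : ℕ) + M ^ j * ∑ i, (b i : ℕ) * M ^ (i : ℕ) := fun a b => by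
    simp only [Fin.sum_univ_add, Fin.append_left, Fin.append_right, Fin.val_castAdd,
      Fin.val_natAdd, mul_sum, pow_add, mul_left_comm]
  simp only [cantorNat, mem_image, Fintype.mem_piFinset, exists_exists_and_eq_and, ← hsum]
  constructor
  · rintro ⟨c, hc, rfl⟩
    exact ⟨fun i => c (Fin.castAdd k i), fun i => hc _, fun i => c (Fin.natAdd j i),
      fun i => hc _, by rw [Fin.append_castAdd_natAdd]⟩
  · rintro ⟨a, ha, b, hb, rfl⟩
    exact ⟨Fin.append a b, Fin.addCases (by simpa using ha) (by simpa using hb), rfl⟩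

variable {A} in
theorem add_pow_mul_injOn_cantorNat (j k : ℕ) :
    Set.InjOn (fun p : ℕ × ℕ => p.1 + M ^ j * p.2) (cantorNat A j ×ˢ cantorNat A k : Finset _) := by
  rintro ⟨x, y⟩ hp ⟨x', y'⟩ hp' h
  have hx := lt_pow_of_mem_cantorNat (mem_product.mp hp).1
  have hx' := lt_pow_of_mem_cantorNat (mem_product.mp hp').1
  have hmod := congrArg (· % M ^ j) h
  have hdiv := congrArg (· / M ^ j) h
  simp only [Nat.add_mul_mod_self_left, Nat.mod_eq_of_lt hx, Nat.mod_eq_of_lt hx'] at hmod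
  simp only [Nat.add_mul_div_left _ _ (Nat.zero_lt_of_lt hx), Nat.div_eq_of_lt hx,
    Nat.div_eq_of_lt hx', zero_add] at hdiv
  rw [hmod, hdiv]

theorem sum_cantorNat_add {E : Type*} [AddCommMonoid E] (j k : ℕ) (f : ℕ → E) :
    ∑ z ∈ cantorNat A (j + k), f z =
      ∑ x ∈ cantorNat A j, ∑ y ∈ cantorNat A k, f (x + M ^ j * y) := by
  have himage : cantorNat A (j + k) =
      (cantorNat A j ×ˢ cantorNat A k).image fun p => p.1 + M ^ j * p.2 := by
    ext z; simp only [mem_cantorNat_add, mem_image, mem_product, Prod.exists]; aesop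
  rw [himage, sum_image (add_pow_mul_injOn_cantorNat j k), sum_product]

theorem mem_cantorNat_one {x : ℕ} : x ∈ cantorNat A 1 ↔ ∃ a ∈ A, (a : ℕ) = x := by
  simp only [cantorNat, mem_image, Fintype.mem_piFinset, Fin.forall_fin_one, Fin.sum_univ_one,
    Fin.val_zero, pow_zero, mul_one]
  exact ⟨fun ⟨a, ha, h⟩ => ⟨a 0, ha, h⟩, fun ⟨a, ha, h⟩ => ⟨fun _ => a, ha, h⟩⟩

end Cantor

section Submultiplicative

variable {M : ℕ} (A : Finset (Fin M))

theorem natCast_injOn_cantorNat (k : ℕ) :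
    Set.InjOn (Nat.cast : ℕ → ZMod (M ^ k)) (cantorNat A k) := fun x hx y hy h => by
  rwa [ZMod.natCast_eq_natCast_iff', Nat.mod_eq_of_lt (lt_pow_of_mem_cantorNat hx),
    Nat.mod_eq_of_lt (lt_pow_of_mem_cantorNat hy)] at h

theorem sum_cantorSet {E : Type*} [AddCommMonoid E] (k : ℕ) (f : ZMod (M ^ k) → E) :
    ∑ z ∈ cantorSet M A k, f z = ∑ x ∈ cantorNat A k, f x := by
  rw [cantorSet_eq_image_cantorNat, sum_image (natCast_injOn_cantorNat A k)]

theorem card_cantorSet (k : ℕ) : #(cantorSet M A k) = #A ^ k := by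
  rw [cantorSet_eq_image_cantorNat, card_image_of_injOn (natCast_injOn_cantorNat A k),
    card_cantorNat]

/-- The map induced by `f` on additive quadruples, in the encoding of `Finset.addEnergy`. -/
def mapQuadruple {α β : Type*} (f : α → β) : (α × α) × α × α → (β × β) × β × β :=
  Prod.map (Prod.map f f) (Prod.map f f)

/-- The residue mod `M ^ k` of the number formed by the base-`M` digits of `z` from position `j`
on. -/
def highPart (j k : ℕ) (z : ZMod (M ^ (j + k))) : ZMod (M ^ k) := (z.val / M ^ j : ℕ)

/-- The residue mod `M ^ j` of the number formed by the last `j` base-`M` digits of `z`. -/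
def lowPart (j k : ℕ) : ZMod (M ^ (j + k)) →+* ZMod (M ^ j) :=
  ZMod.castHom (pow_dvd_pow M (Nat.le_add_right j k)) _

variable {j k : ℕ}

theorem lowPart_mem_cantorSet {z : ZMod (M ^ (j + k))} (hz : z ∈ cantorSet M A (j + k)) :
    lowPart j k z ∈ cantorSet M A j := by
  rw [cantorSet_eq_image_cantorNat] at *
  obtain ⟨n, hn, rfl⟩ := mem_image.mp hz
  obtain ⟨x, hx, y, -, rfl⟩ := (mem_cantorNat_add A).mp hn
  refine mem_image.mpr ⟨x, hx, ?_⟩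
  rw [map_natCast, ZMod.natCast_eq_natCast_iff', Nat.add_mul_mod_self_left]

theorem highPart_mem_cantorSet {z : ZMod (M ^ (j + k))} (hz : z ∈ cantorSet M A (j + k)) :
    highPart j k z ∈ cantorSet M A k := by
  rw [cantorSet_eq_image_cantorNat] at *
  obtain ⟨n, hn, rfl⟩ := mem_image.mp hz
  have hlt := lt_pow_of_mem_cantorNat hn
  obtain ⟨x, hx, y, hy, rfl⟩ := (mem_cantorNat_add A).mp hn
  have hxlt := lt_pow_of_mem_cantorNat hx
  refine mem_image.mpr ⟨y, hy, ?_⟩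
  rw [highPart, ZMod.val_natCast, Nat.mod_eq_of_lt hlt,
    Nat.add_mul_div_left _ _ (Nat.zero_lt_of_lt hxlt), Nat.div_eq_of_lt hxlt, zero_add]

variable [NeZero M]

theorem pow_mul_intCast_eq_zero_iff {s : ℤ} :
    (((M : ℤ) ^ j * s : ℤ) : ZMod (M ^ (j + k))) = 0 ↔ (s : ZMod (M ^ k)) = 0 := by
  rw [ZMod.intCast_zmod_eq_zero_iff_dvd, ZMod.intCast_zmod_eq_zero_iff_dvd, pow_add]
  push_cast
  exact mul_dvd_mul_iff_left (by simp [NeZero.ne M])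

theorem exists_sub_eq_of_lowPart_eq {z w : ZMod (M ^ (j + k))}
    (h : lowPart j k z = lowPart j k w) :
    ∃ s : ℤ, z - w = ((M : ℤ) ^ j * s : ℤ) ∧
      (s : ZMod (M ^ k)) = highPart j k z - highPart j k w := by
  refine ⟨(z.val / M ^ j : ℕ) - (w.val / M ^ j : ℕ), ?_, by
    rw [Int.cast_sub, Int.cast_natCast, Int.cast_natCast, highPart, highPart]⟩
  have hmod : z.val % M ^ j = w.val % M ^ j := by
    rw [← ZMod.natCast_eq_natCast_iff']
    simpa [lowPart] using h
  have hz := Nat.mod_add_div z.val (M ^ j)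
  have hw := Nat.mod_add_div w.val (M ^ j)
  calc z - w = ((z.val - w.val : ℤ) : ZMod (M ^ (j + k))) := by
        rw [Int.cast_sub, Int.cast_natCast, Int.cast_natCast, ZMod.natCast_zmod_val,
          ZMod.natCast_zmod_val]
    _ = _ := congrArg _ (by zify at hmod hz hw ⊢; linear_combination hmod - hz + hw)

theorem eq_of_lowPart_eq_of_highPart_eq {z w : ZMod (M ^ (j + k))}
    (hlow : lowPart j k z = lowPart j k w) (hhigh : highPart j k z = highPart j k w) : z = w := by
  obtain ⟨s, hs, hs'⟩ := exists_sub_eq_of_lowPart_eq hlow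
  rw [← sub_eq_zero, hs, pow_mul_intCast_eq_zero_iff, hs', hhigh, sub_self]

/-- The carry into the high parts of an additive quadruple depends only on the low parts. -/
theorem highPart_add_eq_add_add {x y : (ZMod (M ^ (j + k)) × ZMod (M ^ (j + k))) ×
    ZMod (M ^ (j + k)) × ZMod (M ^ (j + k))}
    (hx : x.1.1 + x.2.1 = x.1.2 + x.2.2) (hy : y.1.1 + y.2.1 = y.1.2 + y.2.2)
    (h : mapQuadruple (lowPart j k) x = mapQuadruple (lowPart j k) y) :
    highPart j k x.1.1 + highPart j k x.2.1 = highPart j k x.1.2 + highPart j k x.2.2 +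
      (highPart j k y.1.1 + highPart j k y.2.1 - (highPart j k y.1.2 + highPart j k y.2.2)) := by
  simp only [mapQuadruple, Prod.map, Prod.mk.injEq] at h
  obtain ⟨⟨h₁₁, h₁₂⟩, h₂₁, h₂₂⟩ := h
  obtain ⟨a, ha, ha'⟩ := exists_sub_eq_of_lowPart_eq h₁₁
  obtain ⟨b, hb, hb'⟩ := exists_sub_eq_of_lowPart_eq h₂₁
  obtain ⟨c, hc, hc'⟩ := exists_sub_eq_of_lowPart_eq h₁₂
  obtain ⟨d, hd, hd'⟩ := exists_sub_eq_of_lowPart_eq h₂₂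
  have hsum : (((M : ℤ) ^ j * (a + b - c - d) : ℤ) : ZMod (M ^ (j + k))) = 0 := by
    push_cast at ha hb hc hd ⊢
    linear_combination hx - hy - ha - hb + hc + hd
  rw [pow_mul_intCast_eq_zero_iff] at hsum
  push_cast at hsum
  linear_combination hsum - ha' - hb' + hc' + hd'

theorem addEnergy_cantorSet_add_le (j k : ℕ) :
    (cantorSet M A (j + k)).addEnergy (cantorSet M A (j + k)) ≤
      (cantorSet M A j).addEnergy (cantorSet M A j) *
        (cantorSet M A k).addEnergy (cantorSet M A k) := by
  rw [mul_comm]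
  refine card_le_mul_card_image_of_maps_to (f := mapQuadruple (lowPart j k)) (fun x hx => ?_) _
    fun b _ => ?_
  · simp only [mem_filter, mem_product, mapQuadruple, Prod.map] at hx ⊢
    obtain ⟨⟨⟨h₁₁, h₁₂⟩, h₂₁, h₂₂⟩, hadd⟩ := hx
    exact ⟨⟨⟨lowPart_mem_cantorSet A h₁₁, lowPart_mem_cantorSet A h₁₂⟩,
      lowPart_mem_cantorSet A h₂₁, lowPart_mem_cantorSet A h₂₂⟩, by rw [← map_add, hadd, map_add]⟩
  · set F := Finset.filter (fun x => mapQuadruple (lowPart j k) x = b) _ with hF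
    rcases F.eq_empty_or_nonempty with h | ⟨y, hy⟩
    · rw [h, card_empty]; exact Nat.zero_le _
    refine (card_le_card_of_injOn (mapQuadruple (highPart j k)) (fun x hx => ?_)
      fun x hx x' hx' h => ?_).trans (card_filter_add_eq_add_add_le_addEnergy _
        (highPart j k y.1.1 + highPart j k y.2.1 - (highPart j k y.1.2 + highPart j k y.2.2)))
    · rw [mem_coe] at hx ⊢
      simp only [hF, mem_filter, mem_product] at hx hy
      obtain ⟨⟨⟨⟨h₁₁, h₁₂⟩, h₂₁, h₂₂⟩, hadd⟩, hlow⟩ := hx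
      simp only [mem_filter, mem_product, mapQuadruple, Prod.map]
      exact ⟨⟨⟨highPart_mem_cantorSet A h₁₁, highPart_mem_cantorSet A h₁₂⟩,
        highPart_mem_cantorSet A h₂₁, highPart_mem_cantorSet A h₂₂⟩,
        highPart_add_eq_add_add hadd hy.1.2 (hlow.trans hy.2.symm)⟩
    · have hlow := (mem_filter.mp hx).2.trans (mem_filter.mp hx').2.symm
      simp only [mapQuadruple, Prod.map, Prod.mk.injEq] at hlow h
      simp only [Prod.ext_iff]
      exact ⟨⟨eq_of_lowPart_eq_of_highPart_eq hlow.1.1 h.1.1,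
        eq_of_lowPart_eq_of_highPart_eq hlow.1.2 h.1.2⟩,
        eq_of_lowPart_eq_of_highPart_eq hlow.2.1 h.2.1,
        eq_of_lowPart_eq_of_highPart_eq hlow.2.2 h.2.2⟩

theorem stdAddChar_pow_mul (s : ℤ) :
    ZMod.stdAddChar (((M : ℤ) ^ j * s : ℤ) : ZMod (M ^ (j + k))) =
      ZMod.stdAddChar (s : ZMod (M ^ k)) := by
  have hM : (M : ℂ) ≠ 0 := by simp [NeZero.ne M]
  rw [ZMod.stdAddChar_coe, ZMod.stdAddChar_coe]
  congr 1
  push_cast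
  rw [pow_add]
  field_simp

theorem stdAddChar_add_pow_mul_mul (y₁ y₂ x₁ x₂ x₁' x₂' : ℕ) :
    ZMod.stdAddChar (((y₁ + M ^ k * y₂ : ℕ) : ZMod (M ^ (j + k))) *
        (((x₁ + M ^ j * x₂ : ℕ) : ZMod (M ^ (j + k))) -
          ((x₁' + M ^ j * x₂' : ℕ) : ZMod (M ^ (j + k))))) =
      ZMod.stdAddChar (y₁ * (x₁ - x₁') : ZMod (M ^ (j + k))) *
        ZMod.stdAddChar (y₁ * (x₂ - x₂') : ZMod (M ^ k)) *
        ZMod.stdAddChar (y₂ * (x₁ - x₁') : ZMod (M ^ j)) := by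
  have hpow : (M : ZMod (M ^ (j + k))) ^ k * M ^ j = 0 := by
    rw [← pow_add, add_comm k j]; exact_mod_cast ZMod.natCast_self _
  have hk := stdAddChar_pow_mul (M := M) (j := j) (k := k) (y₁ * (x₂ - x₂'))
  have hj := stdAddChar_pow_mul (M := M) (j := k) (k := j) (y₂ * (x₁ - x₁'))
  rw [add_comm k j] at hj
  push_cast at hk hj ⊢
  rw [← hk, ← hj, ← AddChar.map_add_eq_mul, ← AddChar.map_add_eq_mul]
  congr 1
  linear_combination (y₂ * (x₂ - x₂')) * hpow

/-- The fourth-moment sum of the discrete Cantor set `C_k`. -/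
noncomputable def cantorCrossSum (k : ℕ) : ℝ :=
  crossSum ZMod.stdAddChar (cantorSet M A k) (cantorSet M A k)

theorem cantorCrossSum_eq_sum_cantorNat (k : ℕ) :
    cantorCrossSum A k = ∑ x ∈ cantorNat A k, ∑ x' ∈ cantorNat A k,
      ‖∑ y ∈ cantorNat A k, ZMod.stdAddChar (y * (x - x') : ZMod (M ^ k))‖ ^ 2 := by
  simp only [cantorCrossSum, crossSum, sum_cantorSet]

theorem sum_sum_norm_sq_add_pow_mul_le (j k x₁ x₁' : ℕ) :
    ∑ x₂ ∈ cantorNat A k, ∑ x₂' ∈ cantorNat A k, ‖∑ y ∈ cantorNat A (j + k),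
      ZMod.stdAddChar ((y : ZMod (M ^ (j + k))) * (((x₁ + M ^ j * x₂ : ℕ) : ZMod (M ^ (j + k))) -
        ((x₁' + M ^ j * x₂' : ℕ) : ZMod (M ^ (j + k)))))‖ ^ 2 ≤
      ‖∑ y ∈ cantorNat A j, ZMod.stdAddChar (y * (x₁ - x₁') : ZMod (M ^ j))‖ ^ 2 *
        cantorCrossSum A k := by
  have hsplit (f : ℕ → ℂ) : ∑ y ∈ cantorNat A (j + k), f y =
      ∑ y₁ ∈ cantorNat A k, ∑ y₂ ∈ cantorNat A j, f (y₁ + M ^ k * y₂) := by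
    rw [add_comm j k, sum_cantorNat_add]
  let w (y : ZMod (M ^ k)) : ℂ := ZMod.stdAddChar (y.val * (x₁ - x₁') : ZMod (M ^ (j + k)))
  have hw : ∀ y ∈ cantorNat A k,
      w y = ZMod.stdAddChar (y * (x₁ - x₁') : ZMod (M ^ (j + k))) := fun y hy => by
    simp only [w, ZMod.val_natCast, Nat.mod_eq_of_lt (lt_pow_of_mem_cantorNat hy)]
  have h := sum_sum_norm_weighted_sq_le_crossSum ZMod.stdAddChar (cantorSet M A k)
    (cantorSet M A k) (w := w) fun y => (AddChar.norm_apply _ _).le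
  simp only [sum_cantorSet] at h
  refine le_of_eq_of_le ?_ (mul_le_mul_of_nonneg_left h (sq_nonneg _))
  simp only [mul_sum, ← mul_pow, ← norm_mul]
  refine sum_congr rfl fun x₂ _ => sum_congr rfl fun x₂' _ => congrArg (‖·‖ ^ 2) ?_
  simp only [hsplit, stdAddChar_add_pow_mul_mul, ← mul_sum]
  rw [← sum_mul, mul_comm]
  exact congrArg _ (sum_congr rfl fun y hy => by rw [hw y hy])

theorem cantorCrossSum_add_le (j k : ℕ) :
    cantorCrossSum A (j + k) ≤ cantorCrossSum A j * cantorCrossSum A k := by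
  rw [cantorCrossSum_eq_sum_cantorNat A (j + k), cantorCrossSum_eq_sum_cantorNat A j, sum_mul,
    sum_cantorNat_add]
  refine sum_le_sum fun x₁ _ => ?_
  simp only [sum_cantorNat_add A j k (f := fun _ => ‖∑ _ ∈ _, ZMod.stdAddChar _‖ ^ 2)]
  rw [sum_comm, sum_mul]
  exact sum_le_sum fun x₁' _ => sum_sum_norm_sq_add_pow_mul_le A j k x₁ x₁'

end Submultiplicative

section Strictness

theorem addEnergy_lt_card_pow_three {G : Type*} [AddCommGroup G] [DecidableEq G] {S : Finset G}
    {a b c : G} (ha : a ∈ S) (hb : b ∈ S) (hc : c ∈ S) (h : a + b - c ∉ S) :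
    S.addEnergy S < #S ^ 3 := by
  have habc : (a, b, c) ∈ S ×ˢ S ×ˢ S := by simp [ha, hb, hc]
  calc S.addEnergy S ≤ #((S ×ˢ S ×ˢ S).erase (a, b, c)) := by
        refine card_le_card_of_injOn (fun x => (x.1.1, x.2.1, x.1.2)) (fun x hx => ?_)
          fun x hx y hy hxy => ?_
        · simp only [coe_filter, Set.mem_ofPred_eq, mem_product] at hx
          simp only [mem_coe, mem_erase, mem_product, ne_eq, Prod.mk.injEq]
          refine ⟨?_, hx.1.1.1, hx.1.2.1, hx.1.1.2⟩
          rintro ⟨rfl, rfl, rfl⟩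
          exact h (by rw [hx.2, add_sub_cancel_left]; exact hx.1.2.2)
        · simp only [coe_filter, Set.mem_ofPred_eq] at hx hy
          simp only [Prod.mk.injEq] at hxy
          obtain ⟨h₁, h₂, h₃⟩ := hxy
          have h₄ : x.2.2 = y.2.2 := by
            rw [← add_right_inj x.1.2, ← hx.2, h₁, h₂, h₃, hy.2]
          exact Prod.ext (Prod.ext h₁ h₃) (Prod.ext h₂ h₄)
    _ < #(S ×ˢ S ×ˢ S) := card_erase_lt_of_mem habc
    _ = #S ^ 3 := by rw [card_product, card_product]; ring

theorem norm_sum_lt_card {α : Type*} {s : Finset α} {f : α → ℂ}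
    (hf : ∀ x ∈ s, ‖f x‖ = 1) {a b : α} (ha : a ∈ s) (hb : b ∈ s) (h : f a ≠ f b) :
    ‖∑ x ∈ s, f x‖ < #s := by
  classical
  have hb' : b ∈ s.erase a := mem_erase.mpr ⟨fun hba => h (hba ▸ rfl), hb⟩
  have hlt : ‖f a + f b‖ < ‖f a‖ + ‖f b‖ := lt_of_le_of_ne (norm_add_le _ _) fun heq =>
    h (eq_of_norm_eq_of_norm_add_eq ((hf a ha).trans (hf b hb).symm) heq)
  calc ‖∑ x ∈ s, f x‖ = ‖f a + f b + ∑ x ∈ (s.erase a).erase b, f x‖ := by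
        rw [add_assoc, add_sum_erase _ _ hb', add_sum_erase _ _ ha]
    _ < ‖f a‖ + ‖f b‖ + ∑ x ∈ (s.erase a).erase b, ‖f x‖ :=
        (norm_add_le _ _).trans_lt (add_lt_add_of_lt_of_le hlt (norm_sum_le _ _))
    _ = ∑ x ∈ s, ‖f x‖ := by
        rw [add_assoc, add_sum_erase _ (‖f ·‖) hb', add_sum_erase _ (‖f ·‖) ha]
    _ = #s := by rw [sum_congr rfl hf, sum_const, nsmul_eq_mul, mul_one]

theorem crossSum_lt_card_sq_mul_card_sq {R : Type*} [CommRing R] [Finite R]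
    {ψ : AddChar R ℂ} {S T : Finset R} {x x' y y' : R} (hx : x ∈ S) (hx' : x' ∈ S) (hy : y ∈ T)
    (hy' : y' ∈ T) (h : ψ (y * (x - x')) ≠ ψ (y' * (x - x'))) :
    crossSum ψ S T < #S ^ 2 * #T ^ 2 := by
  calc crossSum ψ S T = ∑ p ∈ S ×ˢ S, ‖∑ y ∈ T, ψ (y * (p.1 - p.2))‖ ^ 2 := by
        rw [crossSum, sum_product]
    _ < ∑ _p ∈ S ×ˢ S, (#T : ℝ) ^ 2 := by
        refine sum_lt_sum (fun p _ => ?_) ⟨(x, x'), mem_product.mpr ⟨hx, hx'⟩, ?_⟩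
        · gcongr
          refine (norm_sum_le _ _).trans_eq ?_
          simp only [AddChar.norm_apply, sum_const, nsmul_eq_mul, mul_one]
        · gcongr
          exact norm_sum_lt_card (fun y _ => AddChar.norm_apply _ _) hy hy' h
    _ = #S ^ 2 * #T ^ 2 := by
        rw [sum_const, card_product, nsmul_eq_mul, Nat.cast_mul, sq (#S : ℝ)]

variable {M : ℕ} {A : Finset (Fin M)}

theorem natCast_mem_cantorSet_iff {k n : ℕ} (hn : n < M ^ k) :
    (n : ZMod (M ^ k)) ∈ cantorSet M A k ↔ n ∈ cantorNat A k := by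
  rw [cantorSet_eq_image_cantorNat, mem_image]
  refine ⟨fun ⟨x, hx, h⟩ => ?_, fun h => ⟨n, h, rfl⟩⟩
  rw [ZMod.natCast_eq_natCast_iff', Nat.mod_eq_of_lt hn,
    Nat.mod_eq_of_lt (lt_pow_of_mem_cantorNat hx)] at h
  exact h ▸ hx

theorem natCast_add_mul_mem_cantorSet_two {p q : Fin M} :
    (((p : ℕ) + M * (q : ℕ) : ℕ) : ZMod (M ^ 2)) ∈ cantorSet M A 2 ↔ p ∈ A ∧ q ∈ A := by
  have hlt : (p : ℕ) + M * q < M ^ 2 := by nlinarith [p.isLt, q.isLt]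
  rw [natCast_mem_cantorSet_iff hlt, mem_cantorNat_add A (j := 1) (k := 1)]
  simp only [mem_cantorNat_one, exists_exists_and_eq_and, pow_one]
  refine ⟨fun ⟨a, ha, b, hb, h⟩ => ?_, fun ⟨hp, hq⟩ => ⟨p, hp, q, hq, rfl⟩⟩
  have hM : 0 < M := p.pos
  have hmod := congrArg (· % M) h
  have hdiv := congrArg (· / M) h
  simp only [Nat.add_mul_mod_self_left, Nat.mod_eq_of_lt (Fin.isLt _), Nat.add_mul_div_left _ _ hM,
    Nat.div_eq_of_lt (Fin.isLt _), zero_add, ← Fin.ext_iff] at hmod hdiv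
  exact ⟨hmod ▸ ha, hdiv ▸ hb⟩

open Fin.NatCast in
theorem eq_univ_of_add_one_mem [NeZero M] (hA : A.Nonempty) (h : ∀ a ∈ A, a + 1 ∈ A) :
    A = univ := by
  obtain ⟨a, ha⟩ := hA
  have hmem : ∀ n : ℕ, a + (n : Fin M) ∈ A := fun n => by
    induction n with
    | zero => simpa using ha
    | succ n ih => rw [Nat.cast_succ, ← add_assoc]; exact h _ ih
  refine eq_univ_iff_forall.mpr fun b => ?_
  simpa using hmem (b - a).val

/-- Adding `max A - a` to the last digit `max A` either produces a digit above `max A`, or a carry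
turning the first digit `b` into `b + 1`. -/
theorem exists_add_sub_notMem_cantorSet_two (hA₁ : 1 < #A) (hA₂ : #A < M) :
    ∃ x ∈ cantorSet M A 2, ∃ y ∈ cantorSet M A 2, ∃ z ∈ cantorSet M A 2,
      x + y - z ∉ cantorSet M A 2 := by
  have : NeZero M := ⟨by omega⟩
  by_contra! hclosed
  obtain ⟨m, hm, hmax⟩ := exists_max_image A id (card_pos.mp (by omega))
  obtain ⟨a, ha, ham⟩ := exists_mem_ne hA₁ m
  have ham' : (a : ℕ) < m := lt_of_le_of_ne (hmax a ha) (by rwa [ne_eq, ← Fin.ext_iff])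
  have hdig : ∀ {p q : Fin M}, p ∈ A → q ∈ A →
      (((p : ℕ) + M * (q : ℕ) : ℕ) : ZMod (M ^ 2)) ∈ cantorSet M A 2 := fun hp hq =>
    natCast_add_mul_mem_cantorSet_two.mpr ⟨hp, hq⟩
  have hsum : ∀ b ∈ A, ((2 * m - a + M * b : ℕ) : ZMod (M ^ 2)) ∈ cantorSet M A 2 := by
    intro b hb
    convert hclosed _ (hdig hm hb) _ (hdig hm hm) _ (hdig ha hm) using 1
    rw [eq_sub_iff_add_eq, ← Nat.cast_add, ← Nat.cast_add]
    congr 1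
    omega
  rcases lt_or_ge (2 * (m : ℕ) - a) M with hlt | hge
  · have h : (⟨2 * m - a, hlt⟩ : Fin M) ≤ m :=
      hmax _ (natCast_add_mul_mem_cantorSet_two.mp (hsum m hm)).1
    rw [Fin.le_def] at h
    dsimp only at h
    omega
  · refine hA₂.ne ((eq_univ_of_add_one_mem ⟨m, hm⟩ fun b hb => ?_) ▸ card_fin M)
    have hp : 2 * (m : ℕ) - a - M < M := by omega
    refine (natCast_add_mul_mem_cantorSet_two (p := ⟨_, hp⟩).mp ?_).2
    have hcarry : M * (b + 1 : Fin M).val ≡ M * (b + 1) [MOD M ^ 2] := by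
      rw [sq]
      refine Nat.ModEq.mul_left' M ?_
      rw [Fin.val_add, Fin.val_one', Nat.add_mod_mod]
      exact Nat.mod_modEq _ _
    have hsplit : 2 * (m : ℕ) - a + M * b = 2 * m - a - M + M * (b + 1) := by
      rw [mul_add, mul_one]; omega
    have hb' := hsum b hb
    rwa [hsplit, ← (ZMod.natCast_eq_natCast_iff _ _ _).mpr (hcarry.add_left _)] at hb'

theorem addEnergy_cantorSet_two_lt (hA₁ : 1 < #A) (hA₂ : #A < M) :
    (cantorSet M A 2).addEnergy (cantorSet M A 2) < #A ^ 6 := by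
  obtain ⟨x, hx, y, hy, z, hz, h⟩ := exists_add_sub_notMem_cantorSet_two hA₁ hA₂
  refine (addEnergy_lt_card_pow_three hx hy hz h).trans_eq ?_
  rw [card_cantorSet, ← pow_mul]

theorem cantorCrossSum_two_lt [NeZero M] (hA₁ : 1 < #A) : cantorCrossSum A 2 < #A ^ 8 := by
  obtain ⟨a, ha, b, hb, hab⟩ := one_lt_card.mp hA₁
  have hx := natCast_add_mul_mem_cantorSet_two.mpr ⟨ha, ha⟩
  have hy := natCast_add_mul_mem_cantorSet_two.mpr ⟨hb, ha⟩
  refine (crossSum_lt_card_sq_mul_card_sq hx hy hx hy fun h => ?_).trans_eq ?_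
  · have hsq : (((((a : ℕ) : ℤ) - (b : ℕ)) ^ 2 : ℤ) : ZMod (M ^ 2)) = 0 := by
      have h' := ZMod.injective_stdAddChar h
      push_cast at h' ⊢
      linear_combination h'
    rw [ZMod.intCast_zmod_eq_zero_iff_dvd, Nat.cast_pow, Int.pow_dvd_pow_iff two_ne_zero] at hsq
    have := Int.eq_zero_of_abs_lt_dvd hsq (by rw [abs_lt]; omega)
    exact hab (Fin.ext (by omega))
  · rw [card_cantorSet]; push_cast; ring

end Strictness

section Growth

/-- The growth condition `u k = O(b ^ (k * (e + ε)))` for every `ε > 0`. -/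
def HasGrowthExponent (b : ℝ) (u : ℕ → ℝ) (e : ℝ) : Prop :=
  ∀ ε : ℝ, 0 < ε → ∃ C : ℝ, 0 < C ∧ ∀ k : ℕ, u k ≤ C * (b ^ k) ^ (e + ε)

variable {b e : ℝ} {u : ℕ → ℝ}

theorem HasGrowthExponent.of_one_le (h : ∀ ε : ℝ, 0 < ε → ∃ C : ℝ, 0 < C ∧ ∀ k : ℕ, 1 ≤ k →
    u k ≤ C * (b ^ k) ^ (e + ε)) (hb : 0 ≤ b) : HasGrowthExponent b u e := by
  intro ε hε
  obtain ⟨C, hC, hu⟩ := h ε hε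
  refine ⟨max C (u 0), lt_max_of_lt_left hC, fun k => ?_⟩
  rcases k.eq_zero_or_pos with rfl | hk
  · rw [pow_zero, Real.one_rpow, mul_one]; exact le_max_right _ _
  · exact (hu k hk).trans (by gcongr; exact le_max_left _ _)

theorem HasGrowthExponent.mono {e' : ℝ} (h : HasGrowthExponent b u e) (hb : 1 ≤ b)
    (he : e ≤ e') : HasGrowthExponent b u e' := by
  intro ε hε
  obtain ⟨C, hC, hu⟩ := h ε hε
  refine ⟨C, hC, fun k => (hu k).trans ?_⟩
  gcongr
  exact one_le_pow₀ hb

theorem HasGrowthExponent.min {e' : ℝ} (h : HasGrowthExponent b u e)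
    (h' : HasGrowthExponent b u e') : HasGrowthExponent b u (min e e') := by
  rcases min_choice e e' with he | he <;> rw [he] <;> assumption

theorem HasGrowthExponent.of_le {K : ℝ} (hK : 0 < K) (hb : 1 ≤ b)
    (hu : ∀ k, u k ≤ K * (b ^ k) ^ e) : HasGrowthExponent b u e := by
  refine fun ε hε => ⟨K, hK, fun k => (hu k).trans ?_⟩
  gcongr
  · exact one_le_pow₀ hb
  · linarith

theorem exists_le_mul_pow_of_add_two_le {c : ℝ} (hc : 0 < c) (h : ∀ k, u (k + 2) ≤ c ^ 2 * u k) :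
    ∃ K, 0 < K ∧ ∀ k, u k ≤ K * c ^ k := by
  refine ⟨max 1 (max (u 0) (u 1 / c)), by positivity, fun k => ?_⟩
  set K := max 1 (max (u 0) (u 1 / c)) with hK
  induction k using Nat.twoStepInduction with
  | zero => simp [hK]
  | one =>
    rw [pow_one, ← div_le_iff₀ hc]
    exact (le_max_right _ _).trans (le_max_right _ _)
  | more k ih _ =>
    calc u (k + 2) ≤ c ^ 2 * u k := h k
      _ ≤ c ^ 2 * (K * c ^ k) := by gcongr
      _ = K * c ^ (k + 2) := by ring

theorem exists_hasGrowthExponent_lt (hb : 1 < b) (h2 : 0 < u 2)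
    (hsub : ∀ k, u (2 + k) ≤ u 2 * u k) (hlt : u 2 < (b ^ 2) ^ e) :
    ∃ σ < e, HasGrowthExponent b u σ := by
  have hb0 : 0 < b := one_pos.trans hb
  set σ := Real.logb b (u 2) / 2 with hσ
  have hsq : (b ^ σ) ^ 2 = u 2 := by
    rw [← Real.rpow_mul_natCast hb0.le, hσ, Nat.cast_ofNat, div_mul_cancel₀ _ two_ne_zero,
      Real.rpow_logb hb0 hb.ne' h2]
  have hσe : σ < e := by
    rw [← Real.rpow_lt_rpow_left_iff hb, ← pow_lt_pow_iff_left₀ (by positivity) (by positivity)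
      two_ne_zero, hsq, Real.rpow_pow_comm hb0.le]
    exact hlt
  obtain ⟨K, hK, hu⟩ := exists_le_mul_pow_of_add_two_le (u := u) (c := b ^ σ) (by positivity)
    fun k => by rw [hsq, add_comm]; exact hsub k
  exact ⟨σ, hσe, HasGrowthExponent.of_le hK hb.le fun k => by
    rw [← Real.rpow_pow_comm hb0.le]; exact hu k⟩

end Growth

section Exponents

variable {M : ℕ} {A : Finset (Fin M)}

theorem rpow_dim (hA₁ : 1 < #A) (hA₂ : #A < M) : (M : ℝ) ^ dim M A = #A := by
  have hM : (1 : ℝ) < M := by exact_mod_cast hA₁.trans hA₂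
  have hA : (0 : ℝ) < #A := by exact_mod_cast one_pos.trans hA₁
  rw [dim, Real.log_div_log, Real.rpow_logb (by positivity) hM.ne' hA]

theorem pow_rpow_natCast_mul_dim (hA₁ : 1 < #A) (hA₂ : #A < M) (k r : ℕ) :
    ((M : ℝ) ^ k) ^ (r * dim M A) = (#A : ℝ) ^ (k * r) := by
  rw [← Real.rpow_pow_comm (Nat.cast_nonneg M), mul_comm, Real.rpow_mul_natCast (Nat.cast_nonneg M),
    rpow_dim hA₁ hA₂, ← pow_mul, mul_comm r]

theorem pow_rpow_dim (hA₁ : 1 < #A) (hA₂ : #A < M) (k : ℕ) :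
    ((M : ℝ) ^ k) ^ dim M A = (#A : ℝ) ^ k := by
  simpa using pow_rpow_natCast_mul_dim hA₁ hA₂ k 1

theorem dim_pos (hA₁ : 1 < #A) (hA₂ : #A < M) : 0 < dim M A :=
  div_pos (Real.log_pos (by exact_mod_cast hA₁))
    (Real.log_pos (by exact_mod_cast hA₁.trans hA₂))

theorem cantorSet_nonempty (hA : A.Nonempty) (k : ℕ) : (cantorSet M A k).Nonempty := by
  rw [← card_pos, card_cantorSet]
  exact pow_pos (card_pos.mpr hA) k

theorem cantorCrossSum_pos [NeZero M] (hA : A.Nonempty) (k : ℕ) : 0 < cantorCrossSum A k := by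
  obtain ⟨x, hx⟩ := cantorSet_nonempty hA k
  refine sum_pos' (fun _ _ => by positivity) ⟨x, hx, sum_pos' (fun _ _ => by positivity)
    ⟨x, hx, ?_⟩⟩
  simp only [sub_self, mul_zero, AddChar.map_zero_eq_one, sum_const, nsmul_eq_mul, mul_one,
    Complex.norm_natCast]
  have := card_pos.mpr ⟨x, hx⟩
  positivity

theorem exists_cantorCrossSum_exponent [NeZero M] (hA₁ : 1 < #A) (hA₂ : #A < M) :
    ∃ β, 1 / 2 - dim M A < β ∧ HasGrowthExponent M (cantorCrossSum A) (2 - 4 * β) := by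
  have hA : A.Nonempty := card_pos.mp (one_pos.trans hA₁)
  obtain ⟨σ, hσ, h⟩ := exists_hasGrowthExponent_lt (b := M) (e := (4 : ℕ) * dim M A)
    (by exact_mod_cast hA₁.trans hA₂) (cantorCrossSum_pos hA 2) (cantorCrossSum_add_le A 2)
    (by rw [pow_rpow_natCast_mul_dim hA₁ hA₂]; exact cantorCrossSum_two_lt hA₁)
  push_cast at hσ
  exact ⟨(2 - σ) / 4, by linarith, by rwa [show 2 - 4 * ((2 - σ) / 4) = σ by ring]⟩

/-- The sequence of additive energies of the discrete Cantor sets `C_k`. -/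
noncomputable def cantorEnergy (A : Finset (Fin M)) (k : ℕ) : ℝ :=
  (cantorSet M A k).addEnergy (cantorSet M A k)

theorem gammaA_eq_sSup :
    gammaA M A = sSup {γ | HasGrowthExponent M (cantorEnergy A) (3 * dim M A - γ)} := rfl

theorem one_le_cantorEnergy (hA : A.Nonempty) (k : ℕ) : 1 ≤ cantorEnergy A k :=
  Nat.one_le_cast.mpr (addEnergy_self_pos (cantorSet_nonempty hA k))

theorem HasGrowthExponent.nonneg_of_one_le {b e : ℝ} {u : ℕ → ℝ} (h : HasGrowthExponent b u e)
    (hb : 1 < b) (hu : ∀ k, 1 ≤ u k) : 0 ≤ e := by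
  by_contra! he
  obtain ⟨C, hC, hle⟩ := h (-e / 2) (by linarith)
  have hlt : b ^ (e / 2) < 1 := Real.rpow_lt_one_of_one_lt_of_neg hb (by linarith)
  obtain ⟨k, hk⟩ := exists_pow_lt_of_lt_one (inv_pos.mpr hC) hlt
  have hk' := (hu k).trans (hle k)
  rw [show e + -e / 2 = e / 2 by ring, ← Real.rpow_pow_comm (by linarith)] at hk'
  have hmul := mul_lt_mul_of_pos_left hk hC
  rw [mul_inv_cancel₀ hC.ne'] at hmul
  linarith

theorem gammaA_pos (hA₁ : 1 < #A) (hA₂ : #A < M) : 0 < gammaA M A := by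
  have : NeZero M := ⟨by omega⟩
  have hM : (1 : ℝ) < M := by exact_mod_cast hA₁.trans hA₂
  have hone := one_le_cantorEnergy (card_pos.mp (one_pos.trans hA₁))
  obtain ⟨σ, hσ, h⟩ := exists_hasGrowthExponent_lt (u := cantorEnergy A) (e := (3 : ℕ) * dim M A)
    hM (one_pos.trans_le (hone 2))
    (fun k => by unfold cantorEnergy; exact_mod_cast addEnergy_cantorSet_add_le A 2 k)
    (by
      rw [pow_rpow_natCast_mul_dim hA₁ hA₂, cantorEnergy]
      exact_mod_cast addEnergy_cantorSet_two_lt hA₁ hA₂)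
  push_cast at hσ
  rw [gammaA_eq_sSup]
  have hbdd : BddAbove {γ | HasGrowthExponent M (cantorEnergy A) (3 * dim M A - γ)} :=
    ⟨3 * dim M A, fun γ hγ => sub_nonneg.mp (hγ.nonneg_of_one_le hM hone)⟩
  exact (sub_pos.mpr hσ).trans_le (le_csSup hbdd (by simpa using h))

theorem cantorCrossSum_le_sqrt_mul_cantorEnergy [NeZero M] (k : ℕ) :
    cantorCrossSum A k ≤ √((M : ℝ) ^ k) * cantorEnergy A k := by
  refine le_of_sq_le_sq ?_ (by unfold cantorEnergy; positivity)
  have h := crossSum_sq_le (cantorSet M A k) (cantorSet M A k)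
    (ZMod.isPrimitive_stdAddChar (M ^ k))
  rw [ZMod.card, Nat.cast_pow] at h
  rw [mul_pow, Real.sq_sqrt (by positivity), cantorEnergy, cantorCrossSum]
  linarith

theorem cantorCrossSum_hasGrowthExponent_betaE [NeZero M] (hA₁ : 1 < #A) (hA₂ : #A < M) :
    HasGrowthExponent M (cantorCrossSum A) (2 - 4 * betaE M A) := by
  have hM : (1 : ℝ) ≤ M := by exact_mod_cast (hA₁.trans hA₂).le
  have hγ := gammaA_pos hA₁ hA₂
  have hne : {γ | HasGrowthExponent M (cantorEnergy A) (3 * dim M A - γ)}.Nonempty := by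
    rw [Set.nonempty_iff_ne_empty]
    intro h
    rw [gammaA_eq_sSup, h, Real.sSup_empty] at hγ
    exact hγ.false
  obtain ⟨γ, h, hγlt⟩ := exists_lt_of_lt_csSup hne
    (show gammaA M A / 2 < sSup _ from half_lt_self hγ)
  refine HasGrowthExponent.mono (e := 1 / 2 + (3 * dim M A - γ)) (fun ε hε => ?_) hM
    (by rw [betaE]; linarith)
  obtain ⟨C, hC, hle⟩ := h ε hε
  refine ⟨C, hC, fun k => (cantorCrossSum_le_sqrt_mul_cantorEnergy k).trans ?_⟩
  calc √((M : ℝ) ^ k) * cantorEnergy A k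
      ≤ √((M : ℝ) ^ k) * (C * ((M : ℝ) ^ k) ^ (3 * dim M A - γ + ε)) := by gcongr; exact hle k
    _ = C * ((M : ℝ) ^ k) ^ (1 / 2 + (3 * dim M A - γ) + ε) := by
        rw [add_assoc, Real.rpow_add (by positivity) (1 / 2), Real.sqrt_eq_rpow]; ring

end Exponents

section Cutoff

open fwdDiff

theorem differentiable_fwdDiff {g : ℝ → ℝ} (hg : Differentiable ℝ g) (h : ℝ) :
    Differentiable ℝ (Δ_[h] g) :=
  (hg.comp (differentiable_id.add_const h)).sub hg

theorem deriv_fwdDiff {g : ℝ → ℝ} (hg : Differentiable ℝ g) (h : ℝ) :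
    deriv (Δ_[h] g) = Δ_[h] (deriv g) := by
  funext x
  exact (((hg (x + h)).hasDerivAt.comp_add_const x h).sub (hg x).hasDerivAt).deriv

theorem differentiable_fwdDiff_iterate {g : ℝ → ℝ} (hg : Differentiable ℝ g) (h : ℝ) (L : ℕ) :
    Differentiable ℝ ((Δ_[h])^[L] g) := by
  induction L with
  | zero => exact hg
  | succ L ih => rw [Function.iterate_succ_apply']; exact differentiable_fwdDiff ih h

theorem deriv_fwdDiff_iterate {g : ℝ → ℝ} (hg : Differentiable ℝ g) (h : ℝ) (L : ℕ) :
    deriv ((Δ_[h])^[L] g) = (Δ_[h])^[L] (deriv g) := by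
  induction L with
  | zero => rfl
  | succ L ih =>
    rw [Function.iterate_succ_apply', Function.iterate_succ_apply',
      deriv_fwdDiff (differentiable_fwdDiff_iterate hg h L), ih]

theorem exists_abs_fwdDiff_iterate_le (L : ℕ) {g : ℝ → ℝ} (hg : ContDiff ℝ (⊤ : ℕ∞) g)
    (hc : HasCompactSupport g) :
    ∃ C, 0 ≤ C ∧ ∀ h : ℝ, 0 ≤ h → ∀ x, |(Δ_[h])^[L] g x| ≤ C * h ^ L := by
  induction L generalizing g with
  | zero =>
    obtain ⟨C, hC⟩ := hc.exists_bound_of_continuous hg.continuous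
    exact ⟨C, (norm_nonneg _).trans (hC 0), fun h _ x => by simpa using hC x⟩
  | succ L ih =>
    obtain ⟨C, hC0, hC⟩ := ih (contDiff_infty_iff_deriv.mp hg).2 hc.deriv
    refine ⟨C, hC0, fun h hh x => ?_⟩
    have hd : Differentiable ℝ g := hg.differentiable (by simp)
    have hmvt := convex_univ.norm_image_sub_le_of_norm_deriv_le (f := (Δ_[h])^[L] g) (x := x)
      (y := x + h) (fun y _ => differentiable_fwdDiff_iterate hd h L y)
      (fun y _ => by rw [deriv_fwdDiff_iterate hd]; exact hC h hh y) (Set.mem_univ _)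
      (Set.mem_univ _)
    rw [add_sub_cancel_left, Real.norm_of_nonneg hh, mul_assoc, ← pow_succ] at hmvt
    rwa [Function.iterate_succ_apply']

theorem tsum_fwdDiff_mul_zpow {a : ℤ → ℂ} (ha : a.support.Finite) {ω : ℂ} (hω : ω ≠ 0) :
    ∑' m : ℤ, Δ_[1] a m * ω ^ m = (ω⁻¹ - 1) * ∑' m : ℤ, a m * ω ^ m := by
  have hsum : Summable fun m : ℤ => a m * ω ^ m :=
    summable_of_hasFiniteSupport (ha.subset fun m hm h => hm (by simp only [h, zero_mul]))
  have hshift : ∀ m : ℤ, Δ_[1] a m * ω ^ m = ω⁻¹ * (a (m + 1) * ω ^ (m + 1)) - a m * ω ^ m := by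
    intro m
    rw [fwdDiff, zpow_add₀ hω, zpow_one]
    field_simp
  have hsum_succ : Summable fun m : ℤ => a (m + 1) * ω ^ (m + 1) :=
    hsum.comp_injective (add_left_injective 1)
  have htsum_succ : ∑' m : ℤ, a (m + 1) * ω ^ (m + 1) = ∑' m : ℤ, a m * ω ^ m :=
    (Equiv.addRight (1 : ℤ)).tsum_eq fun m => a m * ω ^ m
  simp only [hshift]
  rw [(hsum_succ.mul_left _).tsum_sub hsum, tsum_mul_left, htsum_succ, sub_mul, one_mul]

theorem finite_support_fwdDiff {a : ℤ → ℂ} (ha : a.support.Finite) :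
    (Δ_[1] a).support.Finite :=
  ((ha.preimage (add_left_injective (1 : ℤ)).injOn).union ha).subset
    (Function.support_sub (fun m => a (m + 1)) a)

theorem tsum_fwdDiff_iterate_mul_zpow {a : ℤ → ℂ} (ha : a.support.Finite) {ω : ℂ} (hω : ω ≠ 0)
    (L : ℕ) : ∑' m : ℤ, (Δ_[1])^[L] a m * ω ^ m = (ω⁻¹ - 1) ^ L * ∑' m : ℤ, a m * ω ^ m := by
  induction L generalizing a with
  | zero => rw [pow_zero, one_mul]; rfl
  | succ L ih =>
    rw [Function.iterate_succ_apply, ih (finite_support_fwdDiff ha), tsum_fwdDiff_mul_zpow ha hω,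
      pow_succ, mul_assoc]

variable {χ : ℝ → ℝ}

theorem fwdDiff_iterate_div_natCast (n L : ℕ) (m : ℤ) :
    (Δ_[1])^[L] (fun m : ℤ => (χ (m / n) : ℂ)) m = ((Δ_[(1 / n : ℝ)])^[L] χ (m / n) : ℝ) := by
  rw [fwdDiff_iter_eq_sum_shift, fwdDiff_iter_eq_sum_shift, Complex.ofReal_sum]
  refine sum_congr rfl fun k _ => ?_
  simp only [zsmul_eq_mul, nsmul_eq_mul]
  push_cast
  rw [add_div, mul_one, mul_one_div]

theorem fwdDiff_iterate_div_natCast_eq_zero (hχ : χ.support ⊆ Set.Ioo 0 1) {n : ℕ} (L : ℕ) {m : ℤ}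
    (hm : m ∉ Ico (-L : ℤ) n) : (Δ_[1])^[L] (fun m : ℤ => (χ (m / n) : ℂ)) m = 0 := by
  rw [fwdDiff_iter_eq_sum_shift]
  refine sum_eq_zero fun k hk => ?_
  have hk' : k ≤ L := Nat.lt_succ_iff.mp (mem_range.mp hk)
  have hχ0 : χ ((m + k • 1 : ℤ) / n) = 0 := by
    by_contra hne
    obtain ⟨hpos, hlt⟩ := hχ hne
    have hn : (0 : ℝ) < n := by
      rcases (Nat.cast_nonneg n : (0 : ℝ) ≤ n).eq_or_lt with h | h
      · rw [← h, div_zero] at hpos; exact absurd hpos (lt_irrefl _)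
      · exact h
    rw [div_pos_iff_of_pos_right hn, Int.cast_pos, nsmul_eq_mul, mul_one] at hpos
    rw [div_lt_one hn, ← Int.cast_natCast, Int.cast_lt, nsmul_eq_mul, mul_one] at hlt
    exact hm (by rw [mem_Ico]; omega)
  rw [hχ0, Complex.ofReal_zero, smul_zero]

theorem sum_range_eq_tsum (hχ : χ.support ⊆ Set.Ioo 0 1) (n : ℕ) (ω : ℂ) :
    ∑ m ∈ range n, (χ (m / n) : ℂ) * ω ^ m = ∑' m : ℤ, (χ (m / n) : ℂ) * ω ^ m := by
  have hvanish : ∀ m : ℤ, m ∉ Ico (-(0 : ℕ) : ℤ) n → (χ (m / n) : ℂ) * ω ^ m = 0 := fun m hm =>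
    mul_eq_zero_of_left (fwdDiff_iterate_div_natCast_eq_zero hχ 0 hm) _
  rw [tsum_eq_sum hvanish, Int.Ico_eq_finset_map, sum_map]
  simp only [Nat.cast_zero, neg_zero, sub_zero, Int.toNat_natCast, Function.Embedding.trans_apply,
    Nat.castEmbedding_apply, addLeftEmbedding_apply, zero_add, Int.cast_natCast, zpow_natCast]

theorem exists_cutoff_sum_bound (hχ : ContDiff ℝ (⊤ : ℕ∞) χ) (hsupp : χ.support ⊆ Set.Ioo 0 1)
    (L : ℕ) : ∃ C, 0 < C ∧ ∀ n : ℕ, 0 < n → ∀ ω : ℂ, ‖ω‖ = 1 →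
      (n * ‖ω - 1‖) ^ L * ‖∑ m ∈ range n, (χ (m / n) : ℂ) * ω ^ m‖ ≤ C * n := by
  have hc : HasCompactSupport χ := .of_support_subset_isCompact isCompact_Icc
    (hsupp.trans Set.Ioo_subset_Icc_self)
  obtain ⟨C, hC0, hC⟩ := exists_abs_fwdDiff_iterate_le L hχ hc
  refine ⟨(C + 1) * (L + 1), by positivity, fun n hn ω hω => ?_⟩
  have hn1 : (1 : ℝ) ≤ n := by exact_mod_cast hn
  have hω0 : ω ≠ 0 := norm_ne_zero_iff.mp (by rw [hω]; exact one_ne_zero)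
  have hinv : ‖ω⁻¹ - 1‖ = ‖ω - 1‖ := by
    rw [← one_div, div_sub_one hω0, norm_div, hω, div_one, norm_sub_rev]
  let a (m : ℤ) : ℂ := χ (m / n)
  have ha : a.support.Finite := (Ico (-(0 : ℕ) : ℤ) n).finite_toSet.subset fun m hm => by
    by_contra h
    exact hm (fwdDiff_iterate_div_natCast_eq_zero hsupp 0 h)
  calc (n * ‖ω - 1‖) ^ L * ‖∑ m ∈ range n, (χ (m / n) : ℂ) * ω ^ m‖
      = n ^ L * ‖∑' m : ℤ, (Δ_[1])^[L] a m * ω ^ m‖ := by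
        rw [tsum_fwdDiff_iterate_mul_zpow ha hω0, norm_mul, norm_pow, hinv, sum_range_eq_tsum hsupp,
          mul_pow, mul_assoc]
    _ = n ^ L * ‖∑ m ∈ Ico (-L : ℤ) n, (Δ_[1])^[L] a m * ω ^ m‖ := by
        rw [tsum_eq_sum fun _ hm => by
          rw [fwdDiff_iterate_div_natCast_eq_zero hsupp L hm, zero_mul]]
    _ ≤ n ^ L * ∑ m ∈ Ico (-L : ℤ) n, C * (1 / n : ℝ) ^ L := by
        gcongr
        refine (norm_sum_le _ _).trans (sum_le_sum fun _ _ => ?_)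
        rw [norm_mul, norm_zpow, hω, _root_.one_zpow, mul_one, fwdDiff_iterate_div_natCast,
          Complex.norm_real]
        exact hC _ (by positivity) _
    _ = C * (n + L) := by
        rw [sum_const, Int.card_Ico, sub_neg_eq_add, ← Nat.cast_add, Int.toNat_natCast,
          nsmul_eq_mul, one_div, inv_pow]
        push_cast
        field_simp
    _ ≤ (C + 1) * (L + 1) * n := by
        have hL : (n : ℝ) + L ≤ (L + 1) * n := by
          nlinarith [(Nat.cast_nonneg L : (0 : ℝ) ≤ L)]
        rw [mul_assoc]
        gcongr
        linarith

theorem four_mul_le_norm_exp_sub_one {θ r : ℝ} (h : ∀ w : ℤ, r ≤ |θ - w|) :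
    4 * r ≤ ‖Complex.exp (2 * Real.pi * θ * Complex.I) - 1‖ := by
  set x := θ - round θ with hx
  have hperiodic : Complex.exp (2 * Real.pi * θ * Complex.I) =
      Complex.exp (Complex.I * (2 * Real.pi * x : ℝ)) := by
    rw [← Complex.exp_periodic.sub_int_mul_eq (round θ), hx]
    push_cast
    ring_nf
  have hsin := Real.mul_abs_le_abs_sin (x := Real.pi * x) (by
    rw [abs_mul, abs_of_pos Real.pi_pos]
    nlinarith [abs_sub_round θ, Real.pi_pos])
  rw [abs_mul, abs_of_pos Real.pi_pos, ← mul_assoc, div_mul_cancel₀ _ Real.pi_ne_zero] at hsin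
  rw [hperiodic, Complex.norm_exp_I_mul_ofReal_sub_one, norm_mul, Real.norm_two, Real.norm_eq_abs,
    show 2 * Real.pi * x / 2 = Real.pi * x by ring]
  linarith [h (round θ)]

end Cutoff

section Fourier

variable {N : ℕ} [NeZero N]

theorem finEquiv_apply (j : Fin N) : ZMod.finEquiv N j = ((j : ℕ) : ZMod N) := by
  cases N with
  | zero => exact j.elim0
  | succ N => exact (Fin.cast_val_eq_self j).symm

theorem natCast_fin_injective : Function.Injective fun j : Fin N => ((j : ℕ) : ZMod N) :=
  fun i j h => (ZMod.finEquiv N).injective (by rwa [finEquiv_apply, finEquiv_apply])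

theorem sum_fin_natCast {E : Type*} [AddCommMonoid E] (f : ZMod N → E) :
    ∑ j : Fin N, f (j : ℕ) = ∑ z, f z :=
  Fintype.sum_equiv (ZMod.finEquiv N).toEquiv _ _ fun j => congrArg f (finEquiv_apply j).symm

theorem fourierEntry_eq_stdAddChar (j l : ℕ) :
    fourierEntry N j l = ZMod.stdAddChar (-(j * l) : ZMod N) / (Real.sqrt N : ℂ) := by
  have h := ZMod.stdAddChar_coe (N := N) (-(j * l))
  push_cast at h
  rw [fourierEntry, h]
  ring_nf

omit [NeZero N] in
theorem fourierEntry_comm (j l : ℕ) : fourierEntry N j l = fourierEntry N l j := by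
  rw [fourierEntry, fourierEntry, mul_right_comm _ (j : ℂ)]

theorem norm_fourierEntry_le_one (j l : ℕ) : ‖fourierEntry N j l‖ ≤ 1 := by
  rw [fourierEntry_eq_stdAddChar, norm_div, AddChar.norm_apply, Complex.norm_real,
    Real.norm_of_nonneg (Real.sqrt_nonneg _)]
  exact div_le_one_of_le₀ (Real.one_le_sqrt.mpr (Nat.one_le_cast.mpr NeZero.one_le))
    (Real.sqrt_nonneg _)

theorem star_fourierEntry_mul (p j q l : ℕ) :
    star (fourierEntry N p j) * fourierEntry N q l =
      ZMod.stdAddChar (p * j - q * l : ZMod N) / N := by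
  have hsqrt : (Real.sqrt N : ℂ) * Real.sqrt N = N := by
    rw [← Complex.ofReal_mul, Real.mul_self_sqrt (Nat.cast_nonneg N), Complex.ofReal_natCast]
  rw [Complex.star_def, fourierEntry_eq_stdAddChar, fourierEntry_eq_stdAddChar, map_div₀,
    Complex.conj_ofReal, div_mul_div_comm, hsqrt, ← AddChar.map_neg_eq_conj,
    ← AddChar.map_add_eq_mul, neg_neg, sub_eq_add_neg]

theorem fourierMatrix_mem_unitaryGroup : fourierMatrix N ∈ unitaryGroup (Fin N) ℂ := by
  have hN : (N : ℂ) ≠ 0 := Nat.cast_ne_zero.mpr (NeZero.ne N)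
  rw [mem_unitaryGroup_iff']
  ext j l
  have hterm : ∀ p : Fin N, star (fourierMatrix N) j p * fourierMatrix N p l =
      ZMod.stdAddChar ((p : ℕ) * ((j : ℕ) - (l : ℕ)) : ZMod N) / N := fun p => by
    rw [mul_sub]
    exact star_fourierEntry_mul _ _ _ _
  rw [mul_apply, one_apply]
  simp only [hterm]
  rw [sum_fin_natCast fun z => ZMod.stdAddChar (z * ((j : ℕ) - (l : ℕ) : ZMod N)) / (N : ℂ),
    ← sum_div, AddChar.sum_mulShift _ (ZMod.isPrimitive_stdAddChar N), ZMod.card]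
  simp only [sub_eq_zero, natCast_fin_injective.eq_iff]
  split_ifs
  · rw [div_self hN]
  · rw [Nat.cast_zero, zero_div]

omit [NeZero N] in
theorem conjTranspose_fourierMatrix_transpose : ((fourierMatrix N)ᴴ)ᵀ = (fourierMatrix N)ᴴ := by
  ext j l
  exact congrArg star (fourierEntry_comm _ _)

end Fourier

section Baker

theorem norm_diagonal_le_one {ι : Type*} [Fintype ι] [DecidableEq ι] {v : ι → ℂ}
    (hv : ∀ i, ‖v i‖ ≤ 1) : ‖diagonal v‖ ≤ 1 := by
  rwa [l2_opNorm_diagonal, pi_norm_le_iff_of_nonneg zero_le_one]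

theorem norm_mul_le_one {ι : Type*} [Fintype ι] [DecidableEq ι] {S T : Matrix ι ι ℂ}
    (hS : ‖S‖ ≤ 1) (hT : ‖T‖ ≤ 1) : ‖S * T‖ ≤ 1 :=
  (norm_mul_le S T).trans (mul_le_one₀ hS (norm_nonneg _) hT)

theorem norm_pow_le_one {ι : Type*} [Fintype ι] [DecidableEq ι] {T : Matrix ι ι ℂ}
    (hT : ‖T‖ ≤ 1) (k : ℕ) : ‖T ^ k‖ ≤ 1 := by
  induction k with
  | zero => exact norm_le_one_of_mem_unitaryGroup (one_mem _)
  | succ k ih => rw [pow_succ]; exact norm_mul_le_one ih hT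

theorem blockMatrix_transpose (M : ℕ) (χ : ℝ → ℝ) (N : ℕ) :
    (blockMatrix M χ N)ᵀ = blockMatrix M χ N := by
  ext j l
  simp only [blockMatrix, transpose_apply, of_apply, cutoffFourierEntry]
  rw [fourierEntry_comm, mul_right_comm, mul_comm (χ _ : ℂ), mul_right_comm]
  simp only [eq_comm, mul_comm, mul_left_comm]

variable {M n : ℕ} {A : Finset (Fin M)} {χ : ℝ → ℝ}

theorem norm_alphabetProjection_le_one (N : ℕ) : ‖alphabetProjection M A N‖ ≤ 1 :=
  norm_diagonal_le_one fun j => by split_ifs <;> simp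

theorem reindex_one_kronecker_fourierMatrix_mem_unitaryGroup [NeZero n] :
    reindex finProdFinEquiv finProdFinEquiv ((1 : Matrix (Fin M) (Fin M) ℂ) ⊗ₖ fourierMatrix n) ∈
      unitaryGroup (Fin (M * n)) ℂ := by
  have h := mem_unitaryGroup_iff.mp (kronecker_mem_unitary
    (one_mem (unitaryGroup (Fin M) ℂ)) (fourierMatrix_mem_unitaryGroup (N := n)))
  rw [mem_unitaryGroup_iff, reindex_apply, star_eq_conjTranspose, conjTranspose_submatrix,
    submatrix_mul_equiv, ← star_eq_conjTranspose, h, submatrix_one_equiv]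

variable [NeZero M]

theorem commute_blockMatrix_alphabetProjection :
    Commute (blockMatrix M χ (M * n)) (alphabetProjection M A (M * n)) := by
  have hM : 0 < M := NeZero.pos M
  ext j l
  rw [alphabetProjection, mul_diagonal, diagonal_mul]
  simp only [blockMatrix, of_apply, Nat.mul_div_mul_left _ _ hM, Nat.mul_div_cancel_left _ hM]
  by_cases h : (j : ℕ) / n = l / n
  · rw [h, mul_comm]
  · rw [if_neg h, zero_mul, mul_zero]

theorem bakerMap_apply_eq_zero {N : ℕ} (hN : N = M * n) {j l : Fin N}
    (hl : ¬∃ a ∈ A, (a : ℕ) = l / n) : bakerMap M A χ N j l = 0 := by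
  subst hN
  rw [bakerMap, alphabetProjection, mul_diagonal, Nat.mul_div_mul_left _ _ (NeZero.pos M),
    if_neg hl, mul_zero]

theorem blockMatrix_eq_diagonal_mul_reindex_mul_diagonal :
    blockMatrix M χ (M * n) =
      diagonal (fun j : Fin (M * n) => (χ (((j % n : ℕ) : ℝ) / n) : ℂ)) *
        reindex finProdFinEquiv finProdFinEquiv
          ((1 : Matrix (Fin M) (Fin M) ℂ) ⊗ₖ fourierMatrix n) *
        diagonal (fun j : Fin (M * n) => (χ (((j % n : ℕ) : ℝ) / n) : ℂ)) := by
  ext j l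
  rw [mul_diagonal, diagonal_mul]
  simp only [blockMatrix, of_apply, Nat.mul_div_cancel_left _ (NeZero.pos M), reindex_apply,
    submatrix_apply, kroneckerMap_apply, finProdFinEquiv_symm_apply, one_apply, Fin.ext_iff,
    Fin.coe_divNat, fourierMatrix, Fin.coe_modNat, cutoffFourierEntry]
  split_ifs
  · rw [one_mul]
  · rw [zero_mul, mul_zero, zero_mul]

variable [NeZero n]

theorem fourierMatrix_mul_bakerMap_mul_conjTranspose {N : ℕ} (hN : N = M * n) :
    fourierMatrix N * bakerMap M A χ N * (fourierMatrix N)ᴴ = (bakerMap M A χ N)ᵀ := by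
  subst hN
  have hF : fourierMatrix (M * n) * (fourierMatrix (M * n))ᴴ = 1 :=
    mem_unitaryGroup_iff.mp fourierMatrix_mem_unitaryGroup
  calc fourierMatrix (M * n) * bakerMap M A χ (M * n) * (fourierMatrix (M * n))ᴴ
      = blockMatrix M χ (M * n) * alphabetProjection M A (M * n) * (fourierMatrix (M * n))ᴴ := by
        rw [bakerMap, Matrix.mul_assoc (_ᴴ), ← Matrix.mul_assoc (fourierMatrix _), hF,
          Matrix.one_mul]
    _ = (bakerMap M A χ (M * n))ᵀ := by
        rw [commute_blockMatrix_alphabetProjection.eq, bakerMap, transpose_mul, transpose_mul,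
          conjTranspose_fourierMatrix_transpose, blockMatrix_transpose, Matrix.mul_assoc,
          alphabetProjection, diagonal_transpose]

theorem norm_bakerMap_le_one {N : ℕ} (hN : N = M * n) (hχ : ∀ x, |χ x| ≤ 1) :
    ‖bakerMap M A χ N‖ ≤ 1 := by
  subst hN
  have hcutoff : ‖diagonal fun j : Fin (M * n) => (χ (((j % n : ℕ) : ℝ) / n) : ℂ)‖ ≤ 1 :=
    norm_diagonal_le_one fun j => by rw [Complex.norm_real]; exact hχ _
  have hblock : ‖blockMatrix M χ (M * n)‖ ≤ 1 := by
    rw [blockMatrix_eq_diagonal_mul_reindex_mul_diagonal]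
    exact norm_mul_le_one (norm_mul_le_one hcutoff
      (norm_le_one_of_mem_unitaryGroup reindex_one_kronecker_fourierMatrix_mem_unitaryGroup))
      hcutoff
  refine norm_mul_le_one (norm_mul_le_one ?_ hblock) (norm_alphabetProjection_le_one _)
  rw [l2_opNorm_conjTranspose]
  exact norm_le_one_of_mem_unitaryGroup fourierMatrix_mem_unitaryGroup

omit [NeZero M] [NeZero n] in
theorem star_fourierEntry (N j l : ℕ) :
    star (fourierEntry N j l) =
      Complex.exp (2 * Real.pi * Complex.I * j * l / N) / (Real.sqrt N : ℂ) := by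
  rw [fourierEntry, Complex.star_def, map_div₀, Complex.conj_ofReal, ← Complex.exp_conj]
  simp only [map_neg, map_div₀, map_mul, Complex.conj_ofReal, Complex.conj_I, map_ofNat,
    map_natCast]
  ring_nf

theorem star_fourierEntry_mul_fourierEntry (j l m a : ℕ) :
    star (fourierEntry (M * n) (m + n * a) j) * fourierEntry n m l =
      star (fourierEntry (M * n) (n * a) j) * fourierEntry n 0 0 *
        Complex.exp (2 * Real.pi * (j / (M * n : ℕ) - l / n : ℝ) * Complex.I) ^ m := by
  have hM : (M : ℂ) ≠ 0 := Nat.cast_ne_zero.mpr (NeZero.ne M)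
  have hn : (n : ℂ) ≠ 0 := Nat.cast_ne_zero.mpr (NeZero.ne n)
  rw [star_fourierEntry, star_fourierEntry, fourierEntry, fourierEntry, div_mul_div_comm,
    div_mul_div_comm, div_mul_eq_mul_div, ← Complex.exp_add, ← Complex.exp_add,
    ← Complex.exp_nat_mul, ← Complex.exp_add]
  congr 2
  push_cast
  field_simp
  ring

theorem conjTranspose_fourierMatrix_mul_blockMatrix_apply (j l : Fin (M * n)) :
    ((fourierMatrix (M * n))ᴴ * blockMatrix M χ (M * n)) j l =
      ∑ m : Fin n, star (fourierEntry (M * n) (m + n * (l / n)) j) *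
        cutoffFourierEntry χ n m (l % n) := by
  have hdiv : ∀ p : Fin M × Fin n, (finProdFinEquiv p : ℕ) / n = p.1 := fun p => by
    rw [finProdFinEquiv_apply_val, Nat.add_mul_div_left _ _ (NeZero.pos n),
      Nat.div_eq_of_lt p.2.isLt, zero_add]
  have hmod : ∀ p : Fin M × Fin n, (finProdFinEquiv p : ℕ) % n = p.2 := fun p => by
    rw [finProdFinEquiv_apply_val, Nat.add_mul_mod_self_left, Nat.mod_eq_of_lt p.2.isLt]
  rw [mul_apply, ← finProdFinEquiv.sum_comp, Fintype.sum_prod_type, sum_eq_single l.divNat]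
  · refine sum_congr rfl fun m _ => ?_
    rw [conjTranspose_apply, blockMatrix, fourierMatrix, of_apply, of_apply,
      Nat.mul_div_cancel_left _ (NeZero.pos M), hdiv, hmod, Fin.coe_divNat, if_pos rfl,
      finProdFinEquiv_apply_val, Fin.coe_divNat]
  · intro a _ ha
    refine sum_eq_zero fun m _ => ?_
    rw [blockMatrix, of_apply, Nat.mul_div_cancel_left _ (NeZero.pos M), hdiv, if_neg, mul_zero]
    exact fun h => ha (Fin.ext (h.trans (Fin.coe_divNat l).symm))
  · exact fun h => (h (mem_univ _)).elim

theorem norm_bakerMap_apply_le (j l : Fin (M * n)) :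
    ‖bakerMap M A χ (M * n) j l‖ ≤ |χ (((l % n : ℕ) : ℝ) / n)| *
      ‖∑ m ∈ range n, (χ (m / n) : ℂ) * Complex.exp (2 * Real.pi *
        (j / (M * n : ℕ) - (l % n : ℕ) / n : ℝ) * Complex.I) ^ m‖ := by
  set ω := Complex.exp (2 * Real.pi * (j / (M * n : ℕ) - (l % n : ℕ) / n : ℝ) * Complex.I)
  set c := star (fourierEntry (M * n) (n * (l / n)) j) * fourierEntry n 0 0
  have hc : ‖c‖ ≤ 1 := by
    rw [norm_mul, norm_star]
    exact mul_le_one₀ (norm_fourierEntry_le_one _ _) (norm_nonneg _) (norm_fourierEntry_le_one _ _)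
  have hproj : ‖(if ∃ a ∈ A, (a : ℕ) = M * l / (M * n) then 1 else 0 : ℂ)‖ ≤ 1 := by
    split_ifs <;> simp
  have hsum : ((fourierMatrix (M * n))ᴴ * blockMatrix M χ (M * n)) j l =
      c * (χ (((l % n : ℕ) : ℝ) / n) * ∑ m ∈ range n, (χ (m / n) : ℂ) * ω ^ m) := by
    rw [conjTranspose_fourierMatrix_mul_blockMatrix_apply, sum_range, mul_sum, mul_sum]
    refine sum_congr rfl fun m _ => ?_
    calc star (fourierEntry (M * n) (m + n * (l / n)) j) * cutoffFourierEntry χ n m (l % n)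
        = χ ((m : ℕ) / n) * χ (((l % n : ℕ) : ℝ) / n) *
            (star (fourierEntry (M * n) (m + n * (l / n)) j) * fourierEntry n m (l % n)) := by
          rw [cutoffFourierEntry]; ring
      _ = _ := by rw [star_fourierEntry_mul_fourierEntry]; ring
  rw [bakerMap, alphabetProjection, mul_diagonal, hsum, ← Real.norm_eq_abs, ← Complex.norm_real,
    ← norm_mul, norm_mul, norm_mul c]
  exact (mul_le_of_le_one_right (by positivity) hproj).trans
    (mul_le_of_le_one_left (norm_nonneg _) hc)

end Baker

section OffGraph

variable {χ : ℝ → ℝ}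

theorem exists_support_margin (hsupp : tsupport χ ⊆ Set.Ioo 0 1) :
    ∃ c, 0 < c ∧ ∀ x, χ x ≠ 0 → c ≤ x ∧ c ≤ 1 - x := by
  have hcompact : IsCompact (tsupport χ) :=
    isCompact_Icc.of_isClosed_subset (isClosed_tsupport χ) (hsupp.trans Set.Ioo_subset_Icc_self)
  obtain ⟨c, hc, hsub⟩ := hcompact.exists_cthickening_subset_open isOpen_Ioo hsupp
  have hmem : ∀ x y, χ x ≠ 0 → dist y x ≤ c → y ∈ Set.Ioo (0 : ℝ) 1 := fun x y hx hxy =>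
    hsub (Metric.mem_cthickening_of_dist_le y x c _ (subset_tsupport χ hx) hxy)
  refine ⟨c, hc, fun x hx => ⟨?_, ?_⟩⟩
  · linarith [(hmem x (x - c) hx (by simp [abs_of_pos hc])).1]
  · linarith [(hmem x (x + c) hx (by simp [abs_of_pos hc])).2]

theorem mul_le_abs_sub_sub_intCast {c r x y : ℝ} (hc : 0 ≤ c) (hcx : c ≤ x) (hcx' : c ≤ 1 - x)
    (hy : 0 ≤ y) (hy' : y ≤ 1) (hr : 0 ≤ r) (hr1 : r ≤ 1) (hxy : r ≤ |y - x|) (w : ℤ) :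
    c * r ≤ |y - x - w| := by
  rcases lt_trichotomy w 0 with hw | rfl | hw
  · have hw' : (w : ℝ) ≤ -1 := by exact_mod_cast Int.le_sub_one_of_lt hw
    exact le_trans (by nlinarith) (le_abs_self _)
  · rw [Int.cast_zero, sub_zero]
    nlinarith
  · have hw' : (1 : ℝ) ≤ w := by exact_mod_cast hw
    exact le_trans (by nlinarith) (neg_le_abs _)

theorem le_mul_rpow_neg_of_pow_mul_le {a C K N S ε : ℝ} {L : ℕ} (ha : 0 < a) (hC : 0 ≤ C)
    (hN : 1 ≤ N) (hL : 1 + K ≤ ε * L) (h : (a * N ^ ε) ^ L * S ≤ C * N) :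
    S ≤ C * a⁻¹ ^ L * N ^ (-K) := by
  have hN0 : 0 < N := one_pos.trans_le hN
  have hexp : N * ((N ^ ε) ^ L)⁻¹ ≤ N ^ (-K) := by
    calc N * ((N ^ ε) ^ L)⁻¹ = N ^ (1 - ε * L) := by
          rw [← Real.rpow_mul_natCast hN0.le, Real.rpow_sub hN0, Real.rpow_one, div_eq_mul_inv]
      _ ≤ N ^ (-K) := Real.rpow_le_rpow_of_exponent_le hN (by linarith)
  calc S ≤ C * N / (a * N ^ ε) ^ L := (le_div_iff₀' (by positivity)).mpr h
    _ = C * a⁻¹ ^ L * (N * ((N ^ ε) ^ L)⁻¹) := by rw [mul_pow, inv_pow]; field_simp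
    _ ≤ C * a⁻¹ ^ L * N ^ (-K) := by gcongr

theorem mul_le_mul_norm_exp_sub_one {M n : ℕ} (hM : 0 < M) (hn : 0 < n) {c r x : ℝ} (hc : 0 ≤ c)
    (hcx : c ≤ x) (hcx' : c ≤ 1 - x) (j : Fin (M * n)) (hr : 0 ≤ r) (hr1 : r ≤ M * n)
    (hfar : r ≤ |j - M * (n * x)|) :
    4 * c / M * r ≤
      n * ‖Complex.exp (2 * Real.pi * (j / (M * n) - x : ℝ) * Complex.I) - 1‖ := by
  have hj : (j : ℝ) ≤ M * n := by exact_mod_cast j.2.le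
  have hθ : (j / (M * n) - x : ℝ) = (j - M * (n * x)) / (M * n) := by field_simp
  have hfarθ : r / (M * n) ≤ |(j / (M * n) - x : ℝ)| := by
    rw [hθ, abs_div, abs_of_pos (by positivity : (0 : ℝ) < M * n)]
    gcongr
  have hdist := four_mul_le_norm_exp_sub_one (mul_le_abs_sub_sub_intCast hc hcx hcx'
    (by positivity) (div_le_one_of_le₀ hj (by positivity)) (by positivity)
    (div_le_one_of_le₀ hr1 (by positivity)) hfarθ)
  calc 4 * c / M * r = n * (4 * (c * (r / (M * n)))) := by field_simp
    _ ≤ _ := by gcongr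

theorem exists_offGraph_bound {M : ℕ} [NeZero M] (hχ : ContDiff ℝ (⊤ : ℕ∞) χ)
    (hsupp : tsupport χ ⊆ Set.Ioo 0 1) (hχ1 : ∀ x, |χ x| ≤ 1) {ε : ℝ} (hε : 0 < ε) (hε1 : ε ≤ 1)
    (K : ℝ) :
    ∃ C, 0 < C ∧ ∀ n N : ℕ, 0 < n → N = M * n → ∀ (A : Finset (Fin M)) (j l : Fin N),
      (N : ℝ) ^ ε < |(j : ℝ) - M * (l % n : ℕ)| → ‖bakerMap M A χ N j l‖ ≤ C * (N : ℝ) ^ (-K) := by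
  obtain ⟨c, hc, hmargin⟩ := exists_support_margin hsupp
  obtain ⟨L, hL⟩ := exists_nat_ge ((1 + K) / ε)
  obtain ⟨C, hC, hsum⟩ := exists_cutoff_sum_bound hχ ((subset_tsupport χ).trans hsupp) L
  have hM : (0 : ℝ) < M := Nat.cast_pos.mpr (NeZero.pos M)
  refine ⟨C * (4 * c / M)⁻¹ ^ L, by positivity, ?_⟩
  rintro n _ hn rfl A j l hjl
  have := NeZero.of_pos hn
  have hN : (1 : ℝ) ≤ (M * n : ℕ) := Nat.one_le_cast.mpr (Nat.mul_pos (NeZero.pos M) hn)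
  have hker := norm_bakerMap_apply_le (A := A) (χ := χ) j l
  set x : ℝ := (l % n : ℕ) / n with hx
  by_cases hχx : χ x = 0
  · rw [hχx, abs_zero, zero_mul] at hker
    exact hker.trans (by positivity)
  have hnx : (n * x : ℝ) = (l % n : ℕ) := mul_div_cancel₀ _ (NeZero.ne _)
  rw [← hnx] at hjl
  have hNε := (Real.rpow_le_rpow_of_exponent_le hN hε1).trans_eq (Real.rpow_one _)
  have hgap := mul_le_mul_norm_exp_sub_one (NeZero.pos M) hn hc.le (hmargin x hχx).1
    (hmargin x hχx).2 j (by positivity) (hNε.trans_eq (Nat.cast_mul M n)) hjl.le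
  rw [← Nat.cast_mul] at hgap
  set ω : ℂ := Complex.exp (2 * Real.pi * (j / (M * n : ℕ) - x : ℝ) * Complex.I) with hω
  have hω1 : ‖ω‖ = 1 := by
    rw [hω, ← Complex.norm_exp_ofReal_mul_I (2 * Real.pi * (j / (M * n : ℕ) - x))]
    push_cast
    rfl
  refine hker.trans ((mul_le_of_le_one_left (norm_nonneg _) (hχ1 x)).trans ?_)
  refine le_mul_rpow_neg_of_pow_mul_le (by positivity) hC.le hN ((div_le_iff₀' hε).mp hL) ?_
  calc (4 * c / M * (M * n : ℕ) ^ ε) ^ L * ‖∑ m ∈ range n, (χ (m / n) : ℂ) * ω ^ m‖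
      ≤ (n * ‖ω - 1‖) ^ L * ‖∑ m ∈ range n, (χ (m / n) : ℂ) * ω ^ m‖ := by gcongr
    _ ≤ C * n := hsum n hn ω hω1
    _ ≤ C * (M * n : ℕ) := by
        gcongr
        exact Nat.le_mul_of_pos_left n (NeZero.pos M)

end OffGraph

section Proj

variable {ι : Type*} [DecidableEq ι]

/-- The orthogonal projection of `ℂ^ι` onto the vectors supported in `X`. -/
noncomputable def proj (X : Finset ι) : Matrix ι ι ℂ := diagonal fun i => if i ∈ X then 1 else 0

theorem proj_conjTranspose (X : Finset ι) : (proj X)ᴴ = proj X := by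
  rw [proj, diagonal_conjTranspose]
  congr 1
  ext i
  rw [Pi.star_apply, apply_ite star, star_one, star_zero]

theorem proj_transpose (X : Finset ι) : (proj X)ᵀ = proj X := diagonal_transpose _

variable [Fintype ι]

theorem norm_proj_le_one (X : Finset ι) : ‖proj X‖ ≤ 1 :=
  norm_diagonal_le_one fun i => by split_ifs <;> simp

theorem proj_compl (X : Finset ι) : proj Xᶜ = 1 - proj X := by
  rw [proj, proj, ← diagonal_one, diagonal_sub]
  congr 1
  ext i
  by_cases h : i ∈ X <;> simp [h]

theorem proj_mul_self (X : Finset ι) : proj X * proj X = proj X := by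
  simp only [proj, diagonal_mul_diagonal, mul_ite, mul_one, mul_zero]
  congr 1
  ext i
  split_ifs <;> rfl

theorem proj_mul_mul_proj_apply (X Y : Finset ι) (T : Matrix ι ι ℂ) (i j : ι) :
    (proj X * T * proj Y) i j = if i ∈ X ∧ j ∈ Y then T i j else 0 := by
  rw [proj, proj, mul_diagonal, diagonal_mul]
  by_cases hi : i ∈ X <;> by_cases hj : j ∈ Y <;> simp [hi, hj]

theorem hsNormSq_proj_mul_mul_proj (X Y : Finset ι) (T : Matrix ι ι ℂ) :
    hsNormSq (proj X * T * proj Y) = ∑ i ∈ X, ∑ j ∈ Y, ‖T i j‖ ^ 2 := by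
  simp only [hsNormSq, proj_mul_mul_proj_apply, ite_and, apply_ite norm, norm_zero, ite_pow,
    ne_eq, OfNat.ofNat_ne_zero, not_false_eq_true, zero_pow, sum_ite_irrel, sum_const_zero,
    sum_ite_mem, univ_inter]

end Proj

section NearCantor

variable {M N : ℕ} {A : Finset (Fin M)} {χ : ℝ → ℝ} {E : ℝ}

open Classical in
/-- The indices within `2E` of the intervals of length `r` to the right or left of the points
`r * c`, where `c` runs over the integers with `i` digits, all in the alphabet. -/
noncomputable def nearCantor (A : Finset (Fin M)) (N i r : ℕ) (E : ℝ) : Finset (Fin N) :=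
  {l | ∃ c ∈ cantorNat A i, |(l : ℝ) - r * c| ≤ r + 2 * E}

theorem mem_nearCantor {i r : ℕ} {l : Fin N} :
    l ∈ nearCantor A N i r E ↔ ∃ c ∈ cantorNat A i, |(l : ℝ) - r * c| ≤ r + 2 * E := by
  rw [nearCantor, mem_filter_univ]

theorem nearCantor_zero (hE : 0 ≤ E) : nearCantor A N 0 N E = univ := by
  refine eq_univ_of_forall fun l => mem_nearCantor.mpr ⟨0, by simp [cantorNat], ?_⟩
  rw [Nat.cast_zero, mul_zero, sub_zero, abs_of_nonneg (Nat.cast_nonneg _)]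
  linarith [(Nat.cast_le (α := ℝ)).mpr l.2.le]

theorem mem_nearCantor_succ (hM : 2 ≤ M) (hE : 0 ≤ E) {i n r : ℕ} (hn : n = r * M ^ i)
    {j l : Fin N} (hj : j ∈ nearCantor A N i (M * r) E) (hl : ∃ a ∈ A, (a : ℕ) = l / n)
    (hjl : |(j : ℝ) - M * (l % n : ℕ)| ≤ E) : l ∈ nearCantor A N (i + 1) r E := by
  obtain ⟨c, hc, hjc⟩ := mem_nearCantor.mp hj
  obtain ⟨a, ha, hal⟩ := hl
  refine mem_nearCantor.mpr ⟨c + M ^ i * a,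
    (mem_cantorNat_add A).mpr ⟨c, hc, a, (mem_cantorNat_one A).mpr ⟨a, ha, rfl⟩, rfl⟩, ?_⟩
  have hM' : (2 : ℝ) ≤ M := by exact_mod_cast hM
  have hdigit : (l : ℝ) - r * (c + M ^ i * a : ℕ) = (l % n : ℕ) - r * c := by
    have h : (l : ℝ) = n * a + (l % n : ℕ) := by
      rw [hal]
      exact_mod_cast (Nat.div_add_mod (l : ℕ) n).symm
    rw [h, hn]
    push_cast
    ring
  push_cast at hjc
  rw [hdigit]
  rw [abs_le] at hjc hjl ⊢
  constructor <;> nlinarith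

theorem norm_proj_mul_bakerMap_mul_proj_apply_le [NeZero M] (hM : 2 ≤ M) (hE : 0 ≤ E)
    {i n r : ℕ} (hn : n = r * M ^ i) (hN : N = M * n) {s : ℝ} (hs : 0 ≤ s)
    (hB : ∀ j l : Fin N, E < |(j : ℝ) - M * (l % n : ℕ)| → ‖bakerMap M A χ N j l‖ ≤ s)
    (j l : Fin N) :
    ‖(proj (nearCantor A N i (M * r) E) * bakerMap M A χ N *
      proj (nearCantor A N (i + 1) r E)ᶜ) j l‖ ≤ s := by
  rw [proj_mul_mul_proj_apply]
  split_ifs with h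
  · by_cases hl : ∃ a ∈ A, (a : ℕ) = l / n
    · refine hB j l (lt_of_not_ge fun hjl => ?_)
      exact mem_compl.mp h.2 (mem_nearCantor_succ hM hE hn h.1 hl hjl)
    · rwa [bakerMap_apply_eq_zero hN hl, norm_zero]
  · rwa [norm_zero]

theorem hsNormSq_bakerMap_pow_mul_proj_compl_le [NeZero M] (hM : 2 ≤ M) (hE : 0 ≤ E) {n : ℕ}
    [NeZero n] (hN : N = M * n) (hχ1 : ∀ x, |χ x| ≤ 1) {s : ℝ} (hs : 0 ≤ s)
    (hB : ∀ j l : Fin N, E < |(j : ℝ) - M * (l % n : ℕ)| → ‖bakerMap M A χ N j l‖ ≤ s)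
    {i r : ℕ} (hr : N = r * M ^ i) :
    hsNormSq (bakerMap M A χ N ^ i * proj (nearCantor A N i r E)ᶜ) ≤ 4 ^ i * (N * s) ^ 2 := by
  have hnorm := norm_bakerMap_le_one (A := A) hN hχ1
  induction i generalizing r with
  | zero =>
    obtain rfl : N = r := by rw [hr, pow_zero, mul_one]
    rw [nearCantor_zero hE, compl_univ]
    simp only [proj, notMem_empty, if_false, diagonal_zero, Matrix.mul_zero]
    exact (by simp [hsNormSq] : hsNormSq (0 : Matrix (Fin N) (Fin N) ℂ) = 0).trans_le
      (by positivity)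
  | succ i ih =>
    have hn : n = r * M ^ i := Nat.eq_of_mul_eq_mul_left (NeZero.pos M) <| by
      rw [← hN, hr, pow_succ]; ring
    set B := bakerMap M A χ N
    set X := nearCantor A N i (M * r) E
    set Y := nearCantor A N (i + 1) r E
    have hsplit : B ^ (i + 1) * proj Yᶜ =
        B ^ i * (proj X * B * proj Yᶜ) + (B ^ i * proj Xᶜ) * (B * proj Yᶜ) := by
      rw [pow_succ, proj_compl X]
      noncomm_ring
    have hnear : hsNormSq (B ^ i * (proj X * B * proj Yᶜ)) ≤ (N * s) ^ 2 := by
      refine (hsNormSq_mul_le_right (norm_pow_le_one hnorm i) _).trans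
        ((hsNormSq_le_card_mul_card
          (norm_proj_mul_bakerMap_mul_proj_apply_le hM hE hn hN hs hB)).trans_eq ?_)
      rw [Fintype.card_fin]
      ring
    have hfar : hsNormSq ((B ^ i * proj Xᶜ) * (B * proj Yᶜ)) ≤ 4 ^ i * (N * s) ^ 2 :=
      (hsNormSq_mul_le_left _ (norm_mul_le_one hnorm (norm_proj_le_one _))).trans
        (ih (by rw [hr, pow_succ]; ring))
    have hpow : (1 : ℝ) ≤ 4 ^ i := one_le_pow₀ (by norm_num)
    calc hsNormSq (B ^ (i + 1) * proj Yᶜ) ≤ 2 * (N * s) ^ 2 + 2 * (4 ^ i * (N * s) ^ 2) := by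
          rw [hsplit]
          refine (hsNormSq_add_le _ _).trans ?_
          gcongr
      _ ≤ 2 * (4 ^ i * (N * s) ^ 2) + 2 * (4 ^ i * (N * s) ^ 2) := by
          gcongr; exact le_mul_of_one_le_left (by positivity) hpow
      _ = 4 ^ (i + 1) * (N * s) ^ 2 := by ring

end NearCantor

section FreqProj

variable {N : ℕ}

/-- The projection onto the vectors whose Fourier transform is supported in `X`. -/
noncomputable def freqProj (X : Finset (Fin N)) : Matrix (Fin N) (Fin N) ℂ :=
  (fourierMatrix N)ᴴ * proj X * fourierMatrix N

variable [NeZero N]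

theorem norm_freqProj_le_one (X : Finset (Fin N)) : ‖freqProj X‖ ≤ 1 := by
  have hF := norm_le_one_of_mem_unitaryGroup (fourierMatrix_mem_unitaryGroup (N := N))
  exact norm_mul_le_one (norm_mul_le_one ((l2_opNorm_conjTranspose _).trans_le hF)
    (norm_proj_le_one X)) hF

theorem norm_fourierEntry_sq (j l : ℕ) : ‖fourierEntry N j l‖ ^ 2 = (N : ℝ)⁻¹ := by
  rw [fourierEntry_eq_stdAddChar, norm_div, AddChar.norm_apply, Complex.norm_real,
    Real.norm_of_nonneg (Real.sqrt_nonneg _), div_pow, one_pow, Real.sq_sqrt (Nat.cast_nonneg N),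
    one_div]

theorem hsNormSq_proj_mul_freqProj_le (X : Finset (Fin N)) :
    hsNormSq (proj X * freqProj X) ≤ (#X : ℝ) ^ 2 / N := by
  have hF := norm_le_one_of_mem_unitaryGroup (fourierMatrix_mem_unitaryGroup (N := N))
  calc hsNormSq (proj X * freqProj X)
      = hsNormSq (proj X * (fourierMatrix N)ᴴ * proj X * fourierMatrix N) := by
        simp only [freqProj, Matrix.mul_assoc]
    _ ≤ hsNormSq (proj X * (fourierMatrix N)ᴴ * proj X) := hsNormSq_mul_le_left _ hF
    _ = ∑ _j ∈ X, ∑ _l ∈ X, (N : ℝ)⁻¹ := by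
        rw [hsNormSq_proj_mul_mul_proj]
        simp only [conjTranspose_apply, norm_star, fourierMatrix, of_apply, norm_fourierEntry_sq]
    _ = (#X : ℝ) ^ 2 / N := by simp only [sum_const, nsmul_eq_mul]; ring

theorem freqProj_apply (X : Finset (Fin N)) (j l : Fin N) :
    freqProj X j l = (∑ y ∈ X, ZMod.stdAddChar ((y : ℕ) * ((j : ℕ) - (l : ℕ)) : ZMod N)) / N := by
  rw [freqProj, Matrix.mul_apply, sum_div]
  simp only [proj, mul_diagonal, conjTranspose_apply, mul_ite, mul_one, mul_zero, ite_mul,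
    zero_mul, sum_ite_mem, univ_inter, fourierMatrix, of_apply, star_fourierEntry_mul, mul_sub]

/-- The classes modulo `N` of a set of indices, i.e. its image in the group `ℤ/Nℤ` in which
`crossSum` is computed. -/
def residues (X : Finset (Fin N)) : Finset (ZMod N) := X.image fun l : Fin N => ((l : ℕ) : ZMod N)

theorem sum_residues {E : Type*} [AddCommMonoid E] (X : Finset (Fin N)) (f : ZMod N → E) :
    ∑ x ∈ residues X, f x = ∑ l ∈ X, f (l : ℕ) :=
  sum_image natCast_fin_injective.injOn

theorem hsNormSq_proj_mul_freqProj_mul_conjTranspose (X : Finset (Fin N)) :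
    hsNormSq (proj X * freqProj X * (proj X * freqProj X)ᴴ) =
      crossSum ZMod.stdAddChar (residues X) (residues X) / (N : ℝ) ^ 2 := by
  have hF : fourierMatrix N * (fourierMatrix N)ᴴ = 1 :=
    mem_unitaryGroup_iff.mp fourierMatrix_mem_unitaryGroup
  have hproj : proj X * freqProj X * (proj X * freqProj X)ᴴ = proj X * freqProj X * proj X := by
    simp only [freqProj, conjTranspose_mul, conjTranspose_conjTranspose, proj_conjTranspose]
    calc _ = proj X * ((fourierMatrix N)ᴴ * (proj X * (fourierMatrix N * (fourierMatrix N)ᴴ) *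
          proj X) * fourierMatrix N) * proj X := by simp only [Matrix.mul_assoc]
      _ = _ := by rw [hF, Matrix.mul_one, proj_mul_self]
  simp only [hproj, hsNormSq_proj_mul_mul_proj, crossSum, sum_residues, freqProj_apply, norm_div,
    div_pow, Complex.norm_natCast]
  simp only [sum_div]

end FreqProj

section LocalizedPowers

variable {M N : ℕ} {A : Finset (Fin M)} {χ : ℝ → ℝ} {ε : ℝ}

theorem semiconjBy_fourierMatrix_bakerMap [NeZero M] {n : ℕ} [NeZero n] (hN : N = M * n) :
    SemiconjBy (fourierMatrix N) (bakerMap M A χ N) (bakerMap M A χ N)ᵀ := by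
  have : NeZero N := ⟨hN ▸ NeZero.ne (M * n)⟩
  have hF : (fourierMatrix N)ᴴ * fourierMatrix N = 1 :=
    mem_unitaryGroup_iff'.mp fourierMatrix_mem_unitaryGroup
  rw [SemiconjBy, ← fourierMatrix_mul_bakerMap_mul_conjTranspose hN, Matrix.mul_assoc _ _ᴴ, hF,
    Matrix.mul_one]

theorem hsNormSq_sub_freqProj_mul_le [NeZero N] {T : Matrix (Fin N) (Fin N) ℂ}
    (hT : SemiconjBy (fourierMatrix N) T Tᵀ) (X : Finset (Fin N)) :
    hsNormSq (T - freqProj X * T) ≤ hsNormSq (T * proj Xᶜ) := by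
  have hF := norm_le_one_of_mem_unitaryGroup (fourierMatrix_mem_unitaryGroup (N := N))
  have hFF : (fourierMatrix N)ᴴ * fourierMatrix N = 1 :=
    mem_unitaryGroup_iff'.mp fourierMatrix_mem_unitaryGroup
  have hconj : T - freqProj X * T = (fourierMatrix N)ᴴ * (T * proj Xᶜ)ᵀ * fourierMatrix N := by
    rw [transpose_mul, proj_transpose, proj_compl, Matrix.mul_assoc, Matrix.mul_assoc, ← hT.eq,
      Matrix.sub_mul, Matrix.one_mul, Matrix.mul_sub, ← Matrix.mul_assoc (_ᴴ), hFF,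
      Matrix.one_mul, freqProj]
    simp only [Matrix.mul_assoc]
  calc hsNormSq (T - freqProj X * T) = _ := congr_arg hsNormSq hconj
    _ ≤ hsNormSq ((fourierMatrix N)ᴴ * (T * proj Xᶜ)ᵀ) := hsNormSq_mul_le_left _ hF
    _ ≤ hsNormSq (T * proj Xᶜ)ᵀ :=
      hsNormSq_mul_le_right ((l2_opNorm_conjTranspose _).trans_le hF) _
    _ = hsNormSq (T * proj Xᶜ) := hsNormSq_transpose _

theorem exists_hsNormSq_bakerMap_pow_mul_proj_compl_le [NeZero M] (hM : 2 ≤ M)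
    (A : Finset (Fin M)) (hχ : ContDiff ℝ (⊤ : ℕ∞) χ) (hsupp : tsupport χ ⊆ Set.Ioo 0 1)
    (hχ1 : ∀ x, |χ x| ≤ 1) (hε : 0 < ε) (hε1 : ε ≤ 1) (K : ℝ) :
    ∃ C, 0 < C ∧ ∀ k : ℕ, 1 ≤ k →
      hsNormSq (bakerMap M A χ (M ^ k) ^ k *
        proj (nearCantor A (M ^ k) k 1 (((M : ℝ) ^ k) ^ ε))ᶜ) ≤
          (C * ((M : ℝ) ^ k) ^ (-K)) ^ 2 := by
  obtain ⟨C, hC, hoff⟩ := exists_offGraph_bound (M := M) hχ hsupp hχ1 hε hε1 (K + 2)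
  refine ⟨C, hC, fun k hk => ?_⟩
  obtain ⟨k, rfl⟩ := Nat.exists_eq_add_of_le' hk
  have hN : M ^ (k + 1) = M * M ^ k := pow_succ' M k
  have hoff' := hoff (M ^ k) (M ^ (k + 1)) (NeZero.pos _) hN A
  rw [Nat.cast_pow] at hoff'
  set x : ℝ := (M : ℝ) ^ (k + 1) with hx
  have hx0 : 0 < x := by have := NeZero.pos M; positivity
  have h4 : (4 : ℝ) ^ (k + 1) ≤ x ^ 2 := by
    rw [hx, pow_right_comm]
    have : (2 : ℝ) ≤ M := by exact_mod_cast hM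
    gcongr
    nlinarith
  refine (hsNormSq_bakerMap_pow_mul_proj_compl_le (r := 1) hM (by positivity) hN hχ1
    (by positivity) hoff' (one_mul _).symm).trans ?_
  have hpow : x * x * x ^ (-(K + 2)) = x ^ (-K) := by
    rw [← sq, ← Real.rpow_natCast, ← Real.rpow_add hx0]
    congr 1
    push_cast
    ring
  calc (4 : ℝ) ^ (k + 1) * ((M ^ (k + 1) : ℕ) * (C * x ^ (-(K + 2)))) ^ 2
      ≤ x ^ 2 * (x * (C * x ^ (-(K + 2)))) ^ 2 := by rw [Nat.cast_pow, ← hx]; gcongr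
    _ = (C * x ^ (-K)) ^ 2 := by rw [← hpow]; ring

end LocalizedPowers

section Covering

variable {M k : ℕ} {A : Finset (Fin M)} {E : ℝ}

theorem exists_residues_nearCantor_subset_add (hE : 1 ≤ E) :
    ∃ J : Finset (ZMod (M ^ k)), (#J : ℝ) ≤ 7 * E ∧
      residues (nearCantor A (M ^ k) k 1 E) ⊆ cantorSet M A k + J := by
  have h0 : 0 ≤ ⌊1 + 2 * E⌋ := Int.floor_nonneg.mpr (by linarith)
  refine ⟨(Icc (-⌊1 + 2 * E⌋) ⌊1 + 2 * E⌋).image (Int.cast : ℤ → ZMod (M ^ k)), ?_, ?_⟩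
  · calc (#((Icc (-⌊1 + 2 * E⌋) ⌊1 + 2 * E⌋).image (Int.cast : ℤ → ZMod (M ^ k))) : ℝ)
        ≤ #(Icc (-⌊1 + 2 * E⌋) ⌊1 + 2 * E⌋) := by exact_mod_cast card_image_le
      _ = ((2 * ⌊1 + 2 * E⌋ + 1 : ℤ) : ℝ) := by
          rw [← Int.cast_natCast, Int.card_Icc, Int.toNat_of_nonneg (by lia)]
          congr 1
          ring
      _ ≤ 7 * E := by push_cast; linarith [Int.floor_le (1 + 2 * E)]
  · intro z hz
    obtain ⟨l, hl, rfl⟩ := mem_image.mp hz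
    obtain ⟨c, hc, hlc⟩ := mem_nearCantor.mp hl
    rw [Nat.cast_one, one_mul, abs_le] at hlc
    refine mem_add.mpr ⟨c, ?_, ((l - c : ℤ) : ZMod (M ^ k)), mem_image_of_mem _ (mem_Icc.mpr
      ⟨neg_le.mp (Int.le_floor.mpr ?_), Int.le_floor.mpr ?_⟩), by push_cast; ring⟩
    · rw [cantorSet_eq_image_cantorNat]
      exact mem_image_of_mem _ hc
    · push_cast; linarith
    · push_cast; linarith

variable [NeZero M]

theorem card_nearCantor_le (hE : 1 ≤ E) :
    (#(nearCantor A (M ^ k) k 1 E) : ℝ) ≤ 7 * E * (#A : ℝ) ^ k := by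
  obtain ⟨J, hJ, hsub⟩ := exists_residues_nearCantor_subset_add (A := A) (k := k) hE
  have hcard : #(nearCantor A (M ^ k) k 1 E) ≤ #A ^ k * #J := by
    rw [← card_cantorSet A k, ← card_image_of_injective _ natCast_fin_injective]
    exact (card_le_card hsub).trans card_add_le
  calc (#(nearCantor A (M ^ k) k 1 E) : ℝ) ≤ #A ^ k * #J := by exact_mod_cast hcard
    _ ≤ 7 * E * (#A : ℝ) ^ k := by rw [mul_comm]; gcongr

theorem crossSum_residues_nearCantor_le (hE : 1 ≤ E) :
    crossSum ZMod.stdAddChar (residues (nearCantor A (M ^ k) k 1 E))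
      (residues (nearCantor A (M ^ k) k 1 E)) ≤ (7 * E) ^ 4 * cantorCrossSum A k := by
  obtain ⟨J, hJ, hsub⟩ := exists_residues_nearCantor_subset_add (A := A) (k := k) hE
  calc _ ≤ (#J * #J : ℝ) ^ 2 * cantorCrossSum A k :=
        crossSum_le_of_subset_add_of_subset_add _ _ _ hsub hsub
    _ ≤ (7 * E * (7 * E)) ^ 2 * cantorCrossSum A k := by
        have : 0 ≤ cantorCrossSum A k := crossSum_nonneg _ _ _
        gcongr
    _ = (7 * E) ^ 4 * cantorCrossSum A k := by ring

end Covering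

section Moments

variable {ι : Type*} [Fintype ι] [DecidableEq ι] {T P Q : Matrix ι ι ℂ} {s : ℝ}

theorem hsNormSq_mul_mul_le_add {Y R : Matrix ι ι ℂ} (hY : ‖Y‖ ≤ 1) (hR : ‖R‖ ≤ 1)
    (S S' : Matrix ι ι ℂ) :
    hsNormSq (Y * S * R) ≤ 2 * hsNormSq (Y * S' * R) + 2 * hsNormSq (S - S') := by
  calc hsNormSq (Y * S * R) = hsNormSq (Y * S' * R + Y * ((S - S') * R)) := by
        congr 1; noncomm_ring
    _ ≤ 2 * hsNormSq (Y * S' * R) + 2 * hsNormSq (Y * ((S - S') * R)) := hsNormSq_add_le _ _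
    _ ≤ _ := by
        gcongr
        exact (hsNormSq_mul_le_right hY _).trans (hsNormSq_mul_le_left _ hR)

theorem hsNormSq_mul_le_of_localized (hT : ‖T‖ ≤ 1) {R : Matrix ι ι ℂ} (hR : ‖R‖ ≤ 1) :
    hsNormSq (T * R) ≤ 2 * hsNormSq (P * R) + 2 * hsNormSq (T - T * P) := by
  have h := hsNormSq_mul_mul_le_add (norm_le_one_of_mem_unitaryGroup (one_mem _)) hR T (T * P)
  rw [Matrix.one_mul, Matrix.one_mul, Matrix.mul_assoc] at h
  linarith [hsNormSq_mul_le_right hT (P * R)]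

theorem sum_norm_sq_roots_charpoly_le_hsNormSq_mul_add (hT : ‖T‖ ≤ 1) (hQ : ‖Q‖ ≤ 1) (hs : 0 < s)
    (hQT : hsNormSq (T - Q * T) ≤ s ^ 2) :
    (T.charpoly.roots.map (‖·‖ ^ 2)).sum ≤
      hsNormSq (T * Q) + s * (Fintype.card ι + 1 + s) := by
  have h := sum_norm_sq_roots_charpoly_le_of_approx T hQ (Real.sqrt_pos.mpr hs)
  rw [inv_pow, Real.sq_sqrt hs.le] at h
  calc _ ≤ hsNormSq (T * Q) + s * hsNormSq T + (s⁻¹ + 1) * hsNormSq (T - Q * T) := h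
    _ ≤ hsNormSq (T * Q) + s * Fintype.card ι + (s⁻¹ + 1) * s ^ 2 := by
        gcongr
        exact hsNormSq_le_card hT
    _ = hsNormSq (T * Q) + s * (Fintype.card ι + 1 + s) := by field_simp; ring

theorem sum_norm_sq_roots_charpoly_le_of_localized (hT : ‖T‖ ≤ 1) (hQ : ‖Q‖ ≤ 1) (hs : 0 < s)
    (hTP : hsNormSq (T - T * P) ≤ s ^ 2) (hQT : hsNormSq (T - Q * T) ≤ s ^ 2) :
    (T.charpoly.roots.map (‖·‖ ^ 2)).sum ≤
      2 * hsNormSq (P * Q) + s * (Fintype.card ι + 1 + 15 * s) := by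
  have happrox := sum_norm_sq_roots_charpoly_le_hsNormSq_mul_add hT hQ hs hQT
  have hloc := hsNormSq_mul_le_of_localized (P := P) hT hQ
  nlinarith

theorem hsNormSq_mul_self_mul_le_of_localized (hT : ‖T‖ ≤ 1) (hP : ‖P‖ ≤ 1) (hQ : ‖Q‖ ≤ 1)
    (hTP : hsNormSq (T - T * P) ≤ s ^ 2) (hQT : hsNormSq (T - Q * T) ≤ s ^ 2) :
    hsNormSq (T * T * Q) ≤ 8 * hsNormSq (P * Q * (P * Q)ᴴ) + 14 * s ^ 2 := by
  have hPQ := norm_mul_le_one hP hQ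
  have hQTQ := norm_mul_le_one (norm_mul_le_one hQ hT) hQ
  have insertQ := hsNormSq_mul_mul_le_add hT hQ T (Q * T)
  have insertP := hsNormSq_mul_le_of_localized (P := P) hT hQTQ
  have insertP' := hsNormSq_mul_mul_le_add hPQ hQ T (T * P)
  have htrace := hsNormSq_mul_mul_self_le (P * Q) hT
  simp only [Matrix.mul_assoc] at insertQ insertP insertP' htrace ⊢
  linarith

theorem sum_norm_sq_roots_charpoly_sq_le_of_localized (hT : ‖T‖ ≤ 1) (hP : ‖P‖ ≤ 1)
    (hQ : ‖Q‖ ≤ 1) (hs : 0 < s) (hTP : hsNormSq (T - T * P) ≤ s ^ 2)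
    (hQT : hsNormSq (T - Q * T) ≤ s ^ 2) :
    ((T ^ 2).charpoly.roots.map (‖·‖ ^ 2)).sum ≤
      8 * hsNormSq (P * Q * (P * Q)ᴴ) + s * (Fintype.card ι + 1 + 15 * s) := by
  have hQTT : hsNormSq (T * T - Q * (T * T)) ≤ s ^ 2 := by
    rw [← Matrix.mul_assoc, ← Matrix.sub_mul]
    exact (hsNormSq_mul_le_left _ hT).trans hQT
  have happrox := sum_norm_sq_roots_charpoly_le_hsNormSq_mul_add (norm_mul_le_one hT hT) hQ hs hQTT
  have hloc := hsNormSq_mul_self_mul_le_of_localized hT hP hQ hTP hQT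
  rw [sq T]
  nlinarith

end Moments

section EigenvalueMoments

theorem norm_apply_le_l2_opNorm {m n : Type*} [Fintype m] [Fintype n] [DecidableEq n]
    (T : Matrix m n ℂ) (i : m) (j : n) : ‖T i j‖ ≤ ‖T‖ := by
  have h := l2_opNorm_mulVec T (EuclideanSpace.single j 1)
  rw [PiLp.norm_single, norm_one, mul_one] at h
  simpa using (PiLp.norm_apply_le _ i).trans h

theorem card_filter_norm_mul_pow_le_sum (S : Multiset ℂ) {a : ℝ} (ha : 0 ≤ a) (n : ℕ) :
    (S.filter (a ≤ ‖·‖)).card * a ^ n ≤ (S.map (‖·‖ ^ n)).sum := by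
  calc (S.filter (a ≤ ‖·‖)).card * a ^ n
      = ((S.filter (a ≤ ‖·‖)).map (‖·‖ ^ n)).card • a ^ n := by rw [Multiset.card_map, nsmul_eq_mul]
    _ ≤ ((S.filter (a ≤ ‖·‖)).map (‖·‖ ^ n)).sum := by
        refine Multiset.card_nsmul_le_sum fun y hy => ?_
        obtain ⟨z, hz, rfl⟩ := Multiset.mem_map.mp hy
        gcongr
        exact (Multiset.mem_filter.mp hz).2
    _ ≤ ((S.filter (a ≤ ‖·‖)).map (‖·‖ ^ n)).sum + ((S.filter (¬ a ≤ ‖·‖)).map (‖·‖ ^ n)).sum := by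
        refine le_add_of_nonneg_right (Multiset.sum_nonneg fun y hy => ?_)
        obtain ⟨z, -, rfl⟩ := Multiset.mem_map.mp hy
        positivity
    _ = (S.map (‖·‖ ^ n)).sum := by
        rw [← Multiset.sum_add, ← Multiset.map_add, Multiset.filter_add_not]

theorem roots_charpoly_pow {ι : Type*} [Fintype ι] [DecidableEq ι] (T : Matrix ι ι ℂ) (m : ℕ) :
    (T ^ m).charpoly.roots = T.charpoly.roots.map (· ^ m) := by
  have h := roots_charpoly_aeval T (X ^ m)
  simp only [map_pow, aeval_X, eval_pow, eval_X] at h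
  exact h

variable {M : ℕ} {A : Finset (Fin M)} {χ : ℝ → ℝ}

theorem eigenvalueCount_eq (k : ℕ) (ν : ℝ) : eigenvalueCount M A χ k ν =
    ((bakerMap M A χ (M ^ k)).charpoly.roots.filter ((M : ℝ) ^ (-ν) ≤ ‖·‖)).card := by
  rw [eigenvalueCount]

theorem eigenvalueCount_mono [NeZero M] (k : ℕ) : Monotone (eigenvalueCount M A χ k) := by
  intro ν ν' h
  rw [eigenvalueCount_eq, eigenvalueCount_eq]
  have hM : (1 : ℝ) ≤ M := by exact_mod_cast NeZero.one_le
  exact Multiset.card_le_card (Multiset.monotone_filter_right _ fun z hz =>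
    (Real.rpow_le_rpow_of_exponent_le hM (neg_le_neg h)).trans hz)

variable (M A χ) in
/-- The moment `∑ |λ| ^ (2 m)` over the eigenvalues `λ` of `B_N`, `N = M ^ k`, counted with
algebraic multiplicity. -/
noncomputable def eigenvalueMoment (k m : ℕ) : ℝ :=
  ((bakerMap M A χ (M ^ k)).charpoly.roots.map (‖·‖ ^ (2 * m))).sum

theorem eigenvalueMoment_eq (k m : ℕ) : eigenvalueMoment M A χ k m =
    ((bakerMap M A χ (M ^ k) ^ m).charpoly.roots.map (‖·‖ ^ 2)).sum := by
  rw [eigenvalueMoment, roots_charpoly_pow, Multiset.map_map]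
  simp only [Function.comp_def, norm_pow, ← pow_mul, mul_comm]

theorem HasGrowthExponent.eigenvalueCount_of_moment [NeZero M] {e : ℝ} (r : ℕ)
    (h : HasGrowthExponent M (fun k => eigenvalueMoment M A χ k (r * k)) e) (ν : ℝ) :
    HasGrowthExponent M (fun k => (eigenvalueCount M A χ k ν : ℝ)) (2 * r * ν + e) := by
  intro ε hε
  obtain ⟨C, hC, hmoment⟩ := h ε hε
  refine ⟨C, hC, fun k => ?_⟩
  have hM : (0 : ℝ) < M := by exact_mod_cast NeZero.pos M
  have hcard := card_filter_norm_mul_pow_le_sum (bakerMap M A χ (M ^ k)).charpoly.roots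
    (a := (M : ℝ) ^ (-ν)) (by positivity) (2 * (r * k))
  rw [← eigenvalueCount_eq, ← eigenvalueMoment] at hcard
  have hthreshold : ((M : ℝ) ^ (-ν)) ^ (2 * (r * k)) = (((M : ℝ) ^ k) ^ (2 * r * ν))⁻¹ := by
    rw [← Real.rpow_neg (by positivity), ← Real.rpow_natCast, ← Real.rpow_natCast,
      ← Real.rpow_mul hM.le, ← Real.rpow_mul hM.le]
    congr 1
    push_cast
    ring
  rw [hthreshold, ← div_eq_mul_inv, div_le_iff₀ (by positivity)] at hcard
  calc (eigenvalueCount M A χ k ν : ℝ)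
      ≤ C * ((M : ℝ) ^ k) ^ (e + ε) * ((M : ℝ) ^ k) ^ (2 * r * ν) :=
        hcard.trans (by gcongr; exact hmoment k)
    _ = C * ((M : ℝ) ^ k) ^ (2 * r * ν + e + ε) := by
        rw [mul_assoc, ← Real.rpow_add (by positivity)]
        ring_nf

variable [NeZero M]

theorem localization_error_le {x C K : ℝ} (hx : 1 ≤ x) (hC : 0 ≤ C) (hK : 0 ≤ K) :
    C * x ^ (-K) * (x + 1 + 15 * (C * x ^ (-K))) ≤ C * (2 + 15 * C) * x ^ (1 - K) := by
  have hx0 : 0 < x := by positivity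
  have hxK : x ^ (-K) ≤ x := (Real.rpow_le_one_of_one_le_of_nonpos hx (by linarith)).trans hx
  calc C * x ^ (-K) * (x + 1 + 15 * (C * x ^ (-K)))
      ≤ C * x ^ (-K) * (x + x + 15 * (C * x)) := by gcongr
    _ = C * (2 + 15 * C) * (x * x ^ (-K)) := by ring
    _ = C * (2 + 15 * C) * x ^ (1 - K) := by
        rw [sub_eq_add_neg, Real.rpow_add hx0, Real.rpow_one]

theorem exists_moment_bounds (hM : 2 ≤ M) (A : Finset (Fin M)) (hχ : ContDiff ℝ (⊤ : ℕ∞) χ)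
    (hsupp : tsupport χ ⊆ Set.Ioo 0 1) (hχ1 : ∀ x, |χ x| ≤ 1) {ε K : ℝ} (hε : 0 < ε) (hε1 : ε ≤ 1)
    (hK : 0 ≤ K) :
    ∃ C, 0 < C ∧ ∀ k : ℕ, 1 ≤ k → ∀ X, X = nearCantor A (M ^ k) k 1 (((M : ℝ) ^ k) ^ ε) →
      eigenvalueMoment M A χ k (1 * k) ≤
          2 * hsNormSq (proj X * freqProj X) + C * ((M : ℝ) ^ k) ^ (1 - K) ∧
        eigenvalueMoment M A χ k (2 * k) ≤
          8 * hsNormSq (proj X * freqProj X * (proj X * freqProj X)ᴴ) +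
            C * ((M : ℝ) ^ k) ^ (1 - K) := by
  obtain ⟨C, hC, hloc⟩ := exists_hsNormSq_bakerMap_pow_mul_proj_compl_le hM A hχ hsupp hχ1 hε hε1 K
  refine ⟨C * (2 + 15 * C), by positivity, fun k hk X hX => ?_⟩
  have hTP := hloc k hk
  rw [← hX] at hTP
  obtain ⟨k, rfl⟩ := Nat.exists_eq_add_of_le' hk
  have hN : M ^ (k + 1) = M * M ^ k := pow_succ' M k
  rw [one_mul, eigenvalueMoment_eq, eigenvalueMoment_eq, mul_comm 2 (k + 1), pow_mul]
  have hT := norm_pow_le_one (norm_bakerMap_le_one (A := A) hN hχ1) (k + 1)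
  have hsemi := (semiconjBy_fourierMatrix_bakerMap (A := A) (χ := χ) hN).pow_right (k + 1)
  rw [← transpose_pow] at hsemi
  have hQT := (hsNormSq_sub_freqProj_mul_le hsemi X).trans hTP
  rw [proj_compl, Matrix.mul_sub, Matrix.mul_one] at hTP
  have hx1 : 1 ≤ (M : ℝ) ^ (k + 1) := one_le_pow₀ (by exact_mod_cast NeZero.one_le)
  have hcard : (Fintype.card (Fin (M ^ (k + 1))) : ℝ) = (M : ℝ) ^ (k + 1) := by
    rw [Fintype.card_fin, Nat.cast_pow]
  have hQ := norm_freqProj_le_one X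
  have hs : 0 < C * ((M : ℝ) ^ (k + 1)) ^ (-K) := by positivity
  have herror := localization_error_le hx1 hC.le hK
  have hmoment := sum_norm_sq_roots_charpoly_le_of_localized hT hQ hs hTP hQT
  have hmoment' :=
    sum_norm_sq_roots_charpoly_sq_le_of_localized hT (norm_proj_le_one X) hQ hs hTP hQT
  rw [hcard] at hmoment hmoment'
  exact ⟨hmoment.trans (add_le_add_right herror _), hmoment'.trans (add_le_add_right herror _)⟩

theorem eigenvalueMoment_hasGrowthExponent_dim (hA₁ : 1 < #A) (hA₂ : #A < M)
    (hχ : ContDiff ℝ (⊤ : ℕ∞) χ) (hsupp : tsupport χ ⊆ Set.Ioo 0 1) (hχ1 : ∀ x, |χ x| ≤ 1) :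
    HasGrowthExponent M (fun k => eigenvalueMoment M A χ k (1 * k)) (2 * dim M A - 1) := by
  refine HasGrowthExponent.of_one_le (fun ε hε => ?_) (Nat.cast_nonneg M)
  have hδ := dim_pos hA₁ hA₂
  obtain ⟨C, hC, h⟩ := exists_moment_bounds (K := 2) (hA₁.trans hA₂) A hχ hsupp hχ1
    (show 0 < min (ε / 2) 1 by positivity) (min_le_right _ _) zero_le_two
  refine ⟨98 + C, by positivity, fun k hk => ?_⟩
  obtain ⟨hmoment, -⟩ := h k hk _ rfl
  have hx1 : 1 ≤ (M : ℝ) ^ k := one_le_pow₀ (by exact_mod_cast NeZero.one_le)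
  have hcard := card_nearCantor_le (A := A) (k := k)
    (Real.one_le_rpow hx1 (show 0 ≤ min (ε / 2) 1 by positivity))
  have hHS := hsNormSq_proj_mul_freqProj_le
    (nearCantor A (M ^ k) k 1 (((M : ℝ) ^ k) ^ min (ε / 2) 1))
  rw [← pow_rpow_dim hA₁ hA₂] at hcard
  rw [Nat.cast_pow] at hHS
  set x : ℝ := (M : ℝ) ^ k
  have hx0 : 0 < x := by positivity
  have hmain : (7 * x ^ min (ε / 2) 1 * x ^ dim M A) ^ 2 / x ≤
      49 * x ^ (2 * dim M A - 1 + ε) := by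
    calc (7 * x ^ min (ε / 2) 1 * x ^ dim M A) ^ 2 / x
        ≤ (7 * x ^ (ε / 2) * x ^ dim M A) ^ 2 / x := by gcongr; exact min_le_left _ _
      _ = 49 * (x ^ (ε / 2 + dim M A) * x ^ (ε / 2 + dim M A) * x ^ (-1 : ℝ)) := by
          rw [Real.rpow_add hx0, Real.rpow_neg_one]; ring
      _ = 49 * x ^ (2 * dim M A - 1 + ε) := by
          rw [← Real.rpow_add hx0, ← Real.rpow_add hx0]; ring_nf
  calc _ ≤ 2 * (49 * x ^ (2 * dim M A - 1 + ε)) + C * x ^ (2 * dim M A - 1 + ε) := by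
        refine hmoment.trans (add_le_add ?_ ?_)
        · refine mul_le_mul_of_nonneg_left (hHS.trans (le_trans ?_ hmain)) zero_le_two
          gcongr
        · gcongr
          linarith
    _ = (98 + C) * x ^ (2 * dim M A - 1 + ε) := by ring

theorem eigenvalueMoment_hasGrowthExponent_of_cantorCrossSum (hM : 2 ≤ M)
    (hχ : ContDiff ℝ (⊤ : ℕ∞) χ) (hsupp : tsupport χ ⊆ Set.Ioo 0 1) (hχ1 : ∀ x, |χ x| ≤ 1)
    {β : ℝ} (hβ : HasGrowthExponent M (cantorCrossSum A) (2 - 4 * β)) :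
    HasGrowthExponent M (fun k => eigenvalueMoment M A χ k (2 * k)) (-(4 * β)) := by
  refine HasGrowthExponent.of_one_le (fun ε hε => ?_) (Nat.cast_nonneg M)
  obtain ⟨C₁, hC₁, hcross⟩ := hβ (ε / 2) (by positivity)
  obtain ⟨C, hC, h⟩ := exists_moment_bounds (K := 1 + |4 * β|) hM A hχ hsupp hχ1
    (show 0 < min (ε / 8) 1 by positivity) (min_le_right _ _) (by positivity)
  refine ⟨8 * 7 ^ 4 * C₁ + C, by positivity, fun k hk => ?_⟩
  obtain ⟨-, hmoment⟩ := h k hk _ rfl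
  have hx1 : 1 ≤ (M : ℝ) ^ k := one_le_pow₀ (by exact_mod_cast NeZero.one_le)
  have hcover := crossSum_residues_nearCantor_le (A := A) (k := k)
    (Real.one_le_rpow hx1 (show 0 ≤ min (ε / 8) 1 by positivity))
  rw [hsNormSq_proj_mul_freqProj_mul_conjTranspose, Nat.cast_pow] at hmoment
  have hcross := hcross k
  set x : ℝ := (M : ℝ) ^ k
  have hx0 : 0 < x := by positivity
  have hmain : (7 * x ^ min (ε / 8) 1) ^ 4 * cantorCrossSum A k / x ^ 2 ≤
      7 ^ 4 * C₁ * x ^ (-(4 * β) + ε) := by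
    calc (7 * x ^ min (ε / 8) 1) ^ 4 * cantorCrossSum A k / x ^ 2
        ≤ (7 * x ^ (ε / 8)) ^ 4 * (C₁ * x ^ (2 - 4 * β + ε / 2)) / x ^ 2 := by
          gcongr
          · exact crossSum_nonneg _ _ _
          · exact min_le_left _ _
      _ = 7 ^ 4 * C₁ * (x ^ (ε / 8 * (4 : ℕ)) * x ^ (2 - 4 * β + ε / 2) * x ^ (-(2 : ℕ) : ℝ)) := by
          rw [Real.rpow_mul_natCast hx0.le, Real.rpow_neg hx0.le, Real.rpow_natCast]; ring
      _ = 7 ^ 4 * C₁ * x ^ (-(4 * β) + ε) := by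
          rw [← Real.rpow_add hx0, ← Real.rpow_add hx0]; push_cast; ring_nf
  calc _ ≤ 8 * (7 ^ 4 * C₁ * x ^ (-(4 * β) + ε)) + C * x ^ (-(4 * β) + ε) := by
        refine hmoment.trans (add_le_add ?_ ?_)
        · refine mul_le_mul_of_nonneg_left (le_trans ?_ hmain) (by positivity)
          gcongr
        · gcongr
          linarith [le_abs_self (4 * β)]
    _ = (8 * 7 ^ 4 * C₁ + C) * x ^ (-(4 * β) + ε) := by ring

end EigenvalueMoments

section WeylLaw

variable {M : ℕ} {A : Finset (Fin M)} {χ : ℝ → ℝ}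

theorem eigenvalueCount_le_card_roots_pow (k : ℕ) (ν : ℝ) : eigenvalueCount M A χ k ν ≤
    ((bakerMap M A χ (M ^ k) ^ k).charpoly.roots.filter
      (((M : ℝ) ^ k) ^ (-ν) ≤ ‖·‖)).card := by
  rw [eigenvalueCount_eq, roots_charpoly_pow, Multiset.filter_map, Multiset.card_map]
  refine Multiset.card_le_card (Multiset.monotone_filter_right _ fun z hz => ?_)
  rw [Function.comp_apply, norm_pow, ← Real.rpow_pow_comm (Nat.cast_nonneg M)]
  gcongr

theorem le_rpow_of_mul_log_le {n c X a ν ε δ x : ℝ} (hν : 0 < ν) (ha : 0 ≤ a) (hc : 0 ≤ c)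
    (hδε : 0 ≤ δ + ε) (hx : 2 ≤ x) (hX : X ≤ 7 * x ^ (δ + ε))
    (h : n * (ν * Real.log x) ≤ X * (c * Real.log x) + a) :
    n ≤ (7 * c + a / Real.log 2) / ν * x ^ (δ + ε) := by
  have hlog2 : 0 < Real.log 2 := Real.log_pos one_lt_two
  have hlog : Real.log 2 ≤ Real.log x := Real.log_le_log two_pos hx
  have hpow : 1 ≤ x ^ (δ + ε) := Real.one_le_rpow (by linarith) hδε
  have ha' : a ≤ a / Real.log 2 * Real.log x := by
    rw [div_mul_eq_mul_div, le_div_iff₀ hlog2]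
    gcongr
  rw [div_mul_eq_mul_div, le_div_iff₀ hν]
  refine le_of_mul_le_mul_right ?_ (hlog2.trans_le hlog)
  calc n * ν * Real.log x ≤ X * (c * Real.log x) + a := by rwa [mul_assoc]
    _ ≤ 7 * x ^ (δ + ε) * (c * Real.log x) + a / Real.log 2 * Real.log x * x ^ (δ + ε) := by
        have hlogx : 0 ≤ Real.log x := hlog2.le.trans hlog
        refine add_le_add (by gcongr) (ha'.trans (le_mul_of_one_le_right (by positivity) hpow))
    _ = (7 * c + a / Real.log 2) * x ^ (δ + ε) * Real.log x := by ring

variable [NeZero M]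

theorem exists_norm_bakerMap_pow_apply_le (hM : 2 ≤ M) (A : Finset (Fin M))
    (hχ : ContDiff ℝ (⊤ : ℕ∞) χ) (hsupp : tsupport χ ⊆ Set.Ioo 0 1) (hχ1 : ∀ x, |χ x| ≤ 1)
    {ε : ℝ} (hε : 0 < ε) (hε1 : ε ≤ 1) (K : ℝ) :
    ∃ C, 0 < C ∧ ∀ k : ℕ, 1 ≤ k → ∀ j ∉ nearCantor A (M ^ k) k 1 (((M : ℝ) ^ k) ^ ε),
      ∀ i, ‖(bakerMap M A χ (M ^ k) ^ k) i j‖ ≤ C * ((M : ℝ) ^ k) ^ (-K) := by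
  obtain ⟨C, hC, h⟩ := exists_hsNormSq_bakerMap_pow_mul_proj_compl_le hM A hχ hsupp hχ1 hε hε1 K
  refine ⟨C, hC, fun k hk j hj i => le_of_sq_le_sq ?_ (by positivity)⟩
  have hentry := (norm_apply_sq_le_hsNormSq _ i j).trans (h k hk)
  rwa [proj, mul_diagonal, if_pos (mem_compl.mpr hj), mul_one] at hentry

theorem eigenvalueCount_hasGrowthExponent_dim_of_pos (hA₁ : 1 < #A) (hA₂ : #A < M)
    (hχ : ContDiff ℝ (⊤ : ℕ∞) χ) (hsupp : tsupport χ ⊆ Set.Ioo 0 1) (hχ1 : ∀ x, |χ x| ≤ 1)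
    {ν : ℝ} (hν : 0 < ν) :
    HasGrowthExponent M (fun k => (eigenvalueCount M A χ k ν : ℝ)) (dim M A) := by
  refine HasGrowthExponent.of_one_le (fun ε hε => ?_) (Nat.cast_nonneg M)
  have hM : 2 ≤ M := hA₁.trans hA₂
  have hδ := dim_pos hA₁ hA₂
  have hη : 0 < min ε 1 := by positivity
  obtain ⟨C, hC, hloc⟩ := exists_norm_bakerMap_pow_apply_le hM A hχ hsupp hχ1 hη
    (min_le_right _ _) (2 + 2 * ν)
  refine ⟨(7 * (2 + 2 * ν) + C / Real.log 2) / ν, by positivity, fun k hk => ?_⟩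
  have hx2 : (2 : ℝ) ≤ (M : ℝ) ^ k := by
    exact_mod_cast hM.trans (Nat.le_self_pow (Nat.one_le_iff_ne_zero.mp hk) M)
  have hentry (i j) : ‖(bakerMap M A χ (M ^ k) ^ k) i j‖ ≤ 1 :=
    (norm_apply_le_l2_opNorm _ i j).trans (norm_pow_le_one (norm_bakerMap_le_one
      (by rw [← pow_succ', Nat.sub_add_cancel hk]) hχ1) k)
  have hcard := card_roots_charpoly_filter_mul_log_le hentry
    (by rw [Fintype.card_fin, Nat.cast_pow]) hx2 hν hC.le _ (hloc k hk)
  refine le_rpow_of_mul_log_le hν hC.le (by positivity) (by positivity) hx2 ?_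
    (le_trans ?_ hcard)
  · rw [add_comm, Real.rpow_add (by positivity), pow_rpow_dim hA₁ hA₂, ← mul_assoc]
    refine (card_nearCantor_le (Real.one_le_rpow (by linarith) hη.le)).trans ?_
    gcongr
    · linarith
    · exact min_le_left _ _
  · have hlog := Real.log_pos (one_lt_two.trans_le hx2)
    gcongr
    exact eigenvalueCount_le_card_roots_pow k ν

theorem eigenvalueCount_hasGrowthExponent_dim (hA₁ : 1 < #A) (hA₂ : #A < M)
    (hχ : ContDiff ℝ (⊤ : ℕ∞) χ) (hsupp : tsupport χ ⊆ Set.Ioo 0 1) (hχ1 : ∀ x, |χ x| ≤ 1)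
    (ν : ℝ) : HasGrowthExponent M (fun k => (eigenvalueCount M A χ k ν : ℝ)) (dim M A) := by
  intro ε hε
  obtain ⟨C, hC, h⟩ := eigenvalueCount_hasGrowthExponent_dim_of_pos hA₁ hA₂ hχ hsupp hχ1
    (show 0 < max ν 1 by positivity) ε hε
  exact ⟨C, hC, fun k =>
    (Nat.cast_le.mpr (eigenvalueCount_mono k (le_max_left ν 1))).trans (h k)⟩

end WeylLaw

end OpenBaker

open OpenBaker Finset in
theorem theorem1p3_general {M : ℕ} {A : Finset (Fin M)} (hA₁ : 1 < #A) (hA₂ : #A < M) :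
    0 < gammaA M A ∧ ∃ β, 1 / 2 - dim M A < β ∧ ∀ χ : ℝ → ℝ, ContDiff ℝ (⊤ : ℕ∞) χ →
      tsupport χ ⊆ Set.Ioo 0 1 → (∀ x, |χ x| ≤ 1) → ∀ ν,
        HasGrowthExponent M (fun k => (eigenvalueCount M A χ k ν : ℝ)) (weylExponent M A β ν) := by
  have : NeZero M := ⟨by omega⟩
  refine ⟨gammaA_pos hA₁ hA₂, ?_⟩
  obtain ⟨β, hβ, hcross⟩ := exists_cantorCrossSum_exponent hA₁ hA₂
  refine ⟨β, hβ, fun χ hχ hsupp hχ1 ν => ?_⟩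
  have hfourth {β : ℝ} (h : HasGrowthExponent M (cantorCrossSum A) (2 - 4 * β)) :
      HasGrowthExponent M (fun k => (eigenvalueCount M A χ k ν : ℝ)) (4 * (ν - β)) := by
    convert (eigenvalueMoment_hasGrowthExponent_of_cantorCrossSum (hA₁.trans hA₂) hχ hsupp hχ1
      h).eigenvalueCount_of_moment 2 ν using 1
    push_cast
    ring
  have hsecond : HasGrowthExponent M (fun k => (eigenvalueCount M A χ k ν : ℝ))
      (2 * (ν - (1 / 2 - dim M A))) := by
    convert (eigenvalueMoment_hasGrowthExponent_dim hA₁ hA₂ hχ hsupp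
      hχ1).eigenvalueCount_of_moment 1 ν using 1
    push_cast
    ring
  exact ((hfourth hcross).min (hfourth (cantorCrossSum_hasGrowthExponent_betaE hA₁ hA₂))).min
    (hsecond.min (eigenvalueCount_hasGrowthExponent_dim hA₁ hA₂ hχ hsupp hχ1 ν))

theorem theorem1p3 (M : ℕ) (A : Finset (Fin M)) (hA₁ : 1 < A.card) (hA₂ : A.card < M) :
    0 < OpenBaker.gammaA M A ∧
    ∃ β : ℝ, 1 / 2 - OpenBaker.dim M A < β ∧
      ∀ χ : ℝ → ℝ, ContDiff ℝ (⊤ : ℕ∞) χ → HasCompactSupport χ →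
        tsupport χ ⊆ Set.Ioo 0 1 → (∀ x, χ x ∈ Set.Icc (0 : ℝ) 1) →
        ∀ ν : ℝ, 0 < ν → ∀ ε : ℝ, 0 < ε →
          ∃ C : ℝ, 0 < C ∧ ∀ k : ℕ, 1 ≤ k →
            (OpenBaker.eigenvalueCount M A χ k ν : ℝ) ≤
              C * ((M : ℝ) ^ k) ^ (OpenBaker.weylExponent M A β ν + ε) := by
  obtain ⟨hγ, β, hβ, h⟩ := theorem1p3_general hA₁ hA₂
  refine ⟨hγ, β, hβ, fun χ hχ _ hsupp hχ01 ν _ ε hε => ?_⟩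
  have hχ1 (x) : |χ x| ≤ 1 := abs_le.mpr ⟨by linarith [(hχ01 x).1], (hχ01 x).2⟩
  exact (h χ hχ hsupp hχ1 ν ε hε).imp fun C hC => ⟨hC.1, fun k _ => hC.2 k⟩
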